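/- \textbf{Setting.} $L^2[0,1]$ is the real Hilbert space with norm $\|\cdot\|_2$; $\mathbb I$ is its identity operator and $\mathbb T^{\top}$ the adjoint of a bounded operator $\mathbb T$. A \emph{graphon} is a symmetric measurable function $\mathbf W:[0,1]^2\to[-1,1]$; a bounded measurable kernel $\mathbf W$ acts on $L^2[0,1]$ by $[\mathbf W\mathbf v](x)=\int_0^1\mathbf W(x,y)\mathbf v(y)\,dy$. For $K\ge 1$ let $P_1,\dots,P_K$ be the uniform partition of $[0,1]$, $P_k=[\frac{k-1}{K},\frac kK)$ for $k<K$ and $P_K=[\frac{K-1}K,1]$. Fix $T>0$ and an integer $n\ge1$. For every $N\ge1$ let $A_N,B_N\in\mathbb R^{nN\times nN}$ be symmetric matrices with entries in $[-1,1]$, let $\alpha_N,\beta_N\in\mathbb R$, and let $\mathbf A^{[N]}(x,y)=\sum_{i,j=1}^{nN}\mathbf 1_{P_i}(x)\mathbf 1_{P_j}(y)(A_N)_{ij}$ (with $K=nN$) and similarly $\mathbf B^{[N]}$ be the associated step functions. The $N$-th network system is $\dot{\mathbf x}_t=\mathbb A^{[N]}\mathbf x_t+\mathbb B^{[N]}\mathbf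 u_t$ with $\mathbb A^{[N]}=\alpha_N\mathbb I+\mathbf A^{[N]}$, $\mathbb B^{[N]}=\beta_N\mathbb I+\mathbf B^{[N]}$. Solutions are mild: $\mathbf u\in L^2([0,T];L^2[0,1])$, $\mathbf x\in C([0,T];L^2[0,1])$ and $\mathbf x_t=e^{(t-a)\mathbb A^{[N]}}\mathbf x_a+\int_a^te^{(t-s)\mathbb A^{[N]}}\mathbb B^{[N]}\mathbf u_s\,ds$ for $0\le a\le t\le T$. \textbf{Assumptions.} (1) For every $N\ge1$, $\mathbb P_0^{[N]}$ is a bounded, Hermitian, non-negative operator and $\mathbb C^{[N]}$ a bounded operator on $L^2[0,1]$. (2) There are $\alpha,\beta\in\mathbb R$ and graphons $\mathbf A,\mathbf B$ with $\alpha_N\to\alpha$, $\beta_N\to\beta$, $\|\mathbf A-\mathbf A^{[N]}\|_{\mathrm{op}}\to0$ and $\|\mathbf B-\mathbf B^{[N]}\|_{\mathrm{op}}\to0$; put $\mathbb A=\alpha\mathbb I+\mathbf A$, $\mathbb B=\beta\mathbb I+\mathbf B$. (3) $\mathbb C^{[N]}\to\mathbb C$ and $\mathbb P_0^{[N]}\to\mathbb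 P_0$ strongly, for bounded operators $\mathbb C,\mathbb P_0$. (4) $\mathbb C$ and all $\mathbb C^{[N]}$ are self-adjoint. (5) The initial states $\mathbf x_0^{[N]}\in L^2[0,1]$ converge in $L^2[0,1]$. Let $\mathbb P$ be the solution on $[0,T]$ of the Riccati equation $$\dot{\mathbb P}=\mathbb A^{\top}\mathbb P+\mathbb P\mathbb A-\mathbb P\mathbb B\mathbb B^{\top}\mathbb P+\mathbb C^{\top}\mathbb C$$ with value $\mathbb P_0$ at $t=0$, and $\mathbb P^{N}$ the solution of the same equation with $\mathbb A^{[N]},\mathbb B^{[N]},\mathbb C^{[N]},\mathbb P_0^{[N]}$ in place of $\mathbb A,\mathbb B,\mathbb C,\mathbb P_0$; both are taken in the class of strongly continuous maps from $[0,T]$ to the Hermitian non-negative operators, the derivative being taken pointwise on vectors of $L^2[0,1]$. Let $\overline{\mathbb P}{}^{[N]}_t$ be the step function approximation of $\mathbb P_t$: the integral operator with kernel $$\frac{\langle\mathbf 1_{Q_i},\mathbb P_t\mathbf 1_{Q_j}\rangle}{\mu(Q_i)\mu(Q_j)}\quad\text{on }Q_i\times Q_j,$$ where $Q_1,\dots,Q_{nN}$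 is the uniform partition of $[0,1]$ into $nN$ intervals and $\mu$ is Lebesgue measure. For the $N$-th network system with initial state $\mathbf x_0^{[N]}$, let $(\mathbf u^{N*},\mathbf x^{N*})$ be the control and trajectory under the optimal linear quadratic feedback $\mathbf u^{N*}_t=-\mathbb B^{[N]\top}\mathbb P^{N}_{T-t}\mathbf x^{N*}_t$, and let $(\mathbf u^{[N]},\mathbf x^{[N]})$ be the control and trajectory, with the same initial state, under the graphon approximate feedback $\mathbf u^{[N]}_t=-\mathbb B^{[N]\top}\overline{\mathbb P}{}^{[N]}_{T-t}\mathbf x^{[N]}_t$. The cost of a control $\mathbf u$ with trajectory $\mathbf x$ is $$J(\mathbf u)=\int_0^T\left(\|\mathbb C^{[N]}\mathbf x_t\|_2^2+\|\mathbf u_t\|_2^2\right)dt+\langle\mathbb P_0^{[N]}\mathbf x_T,\mathbf x_T\rangle.$$ \textbf{Theorem.} For every $t\in[0,T]$, $\lim_{N\to\infty}\|\mathbf x^{N*}_t-\mathbf x^{[N]}_t\|_2=0$, and $\lim_{N\to\infty}|J(\mathbf u^{N*})-J(\mathbf u^{[N]})|=0$. -/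

import Mathlib

open MeasureTheory Set Filter Topology
open scoped unitInterval InnerProductSpace InnerProduct

noncomputable section

namespace GraphonLQR

/-- The real Hilbert space `L²[0,1]` (Lebesgue measure on the unit interval). -/
abbrev L2 : Type := Lp ℝ 2 (volume : Measure I)

/-! ### Kernels and the integral operators that they define -/

/-- A bounded measurable kernel on `[0,1]²`. -/
structure BddKernel where
  /-- The kernel as a function of two variables. -/
  toFun : I → I → ℝ
  measurable_uncurry : Measurable (Function.uncurry toFun)
  exists_bound : ∃ c : ℝ, ∀ x y, |toFun x y| ≤ c

namespace BddKernel

theorem ae_bound (W : BddKernel) {c : ℝ} (hc : ∀ x y, |W.toFun x y| ≤ c) (v : L2) (x : I) :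
    ‖∫ y, W.toFun x y * v y‖ ≤ c * ‖v‖ := by
  have hc0 : 0 ≤ c := (abs_nonneg _).trans (hc 0 0)
  have hv2 : MemLp v 2 (volume : Measure I) := Lp.memLp v
  have hvi : Integrable v (volume : Measure I) := hv2.integrable (by norm_num)
  have h1 : ‖∫ y, W.toFun x y * v y‖ ≤ ∫ y, c * ‖v y‖ := by
    refine norm_integral_le_of_norm_le (hvi.norm.const_mul c) (ae_of_all _ fun y => ?_)
    rw [norm_mul]
    exact mul_le_mul_of_nonneg_right (hc x y) (norm_nonneg _)
  refine h1.trans ?_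
  rw [integral_const_mul]
  refine mul_le_mul_of_nonneg_left ?_ hc0
  rw [integral_norm_eq_lintegral_enorm hvi.aestronglyMeasurable, Lp.norm_def]
  refine ENNReal.toReal_mono (Lp.eLpNorm_ne_top v) ?_
  rw [← eLpNorm_one_eq_lintegral_enorm]
  exact eLpNorm_le_eLpNorm_of_exponent_le (by norm_num) hvi.aestronglyMeasurable

theorem integrable_mul (W : BddKernel) (v : L2) (x : I) :
    Integrable (fun y => W.toFun x y * v y) (volume : Measure I) := by
  obtain ⟨c, hc⟩ := W.exists_bound
  have hvi : Integrable v (volume : Measure I) := (Lp.memLp v).integrable (by norm_num)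
  refine hvi.bdd_mul (c := c) ?_ (ae_of_all _ fun y => hc x y)
  exact (W.measurable_uncurry.comp measurable_prodMk_left).aestronglyMeasurable

theorem memLp (W : BddKernel) (v : L2) :
    MemLp (fun x => ∫ y, W.toFun x y * v y) 2 (volume : Measure I) := by
  obtain ⟨c, hc⟩ := W.exists_bound
  refine MemLp.of_bound ?_ (c * ‖v‖) (ae_of_all _ fun x => W.ae_bound hc v x)
  have h : StronglyMeasurable (Function.uncurry fun (x y : I) => W.toFun x y * v y) := by
    refine W.measurable_uncurry.stronglyMeasurable.mul ?_
    exact (Lp.stronglyMeasurable v).comp_measurable measurable_snd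
  exact h.integral_prod_right.aestronglyMeasurable

/-- The integral operator `(W v)(x) = ∫₀¹ W(x, y) v(y) dy` on `L²[0,1]`. -/
def op (W : BddKernel) : L2 →L[ℝ] L2 :=
  LinearMap.mkContinuousOfExistsBound
    { toFun := fun v => (W.memLp v).toLp _
      map_add' := by
        intro v w
        rw [← MemLp.toLp_add]
        refine MemLp.toLp_congr _ _ (ae_of_all _ fun x => ?_)
        rw [Pi.add_apply, ← integral_add (W.integrable_mul v x) (W.integrable_mul w x)]
        refine integral_congr_ae ?_
        filter_upwards [Lp.coeFn_add v w] with y hy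
        rw [hy, Pi.add_apply, mul_add]
      map_smul' := by
        intro r v
        rw [RingHom.id_apply, ← MemLp.toLp_const_smul]
        refine MemLp.toLp_congr _ _ (ae_of_all _ fun x => ?_)
        rw [Pi.smul_apply, smul_eq_mul, ← integral_const_mul]
        refine integral_congr_ae ?_
        filter_upwards [Lp.coeFn_smul r v] with y hy
        rw [hy, Pi.smul_apply, smul_eq_mul]
        ring }
    (by
      obtain ⟨c, hc⟩ := W.exists_bound
      have hc0 : 0 ≤ c := (abs_nonneg _).trans (hc 0 0)
      refine ⟨c, fun v => ?_⟩
      have h := Lp.norm_le_of_ae_bound (f := (W.memLp v).toLp _) (C := c * ‖v‖) (by positivity)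
        (by
          filter_upwards [(W.memLp v).coeFn_toLp] with x hx
          rw [hx]
          exact W.ae_bound hc v x)
      have hm : measureUnivNNReal (volume : Measure I) = 1 := by
        simp [measureUnivNNReal]
      simpa [hm] using h)

/-- The defining formula of the integral operator. -/
theorem coeFn_op (W : BddKernel) (v : L2) :
    W.op v =ᵐ[volume] fun x => ∫ y, W.toFun x y * v y :=
  (W.memLp v).coeFn_toLp

/-- Graphons are the symmetric measurable functions `[0,1]² → [-1,1]`. -/
def IsGraphon (W : BddKernel) : Prop :=
  (∀ x y, W.toFun x y = W.toFun y x) ∧ ∀ x y, |W.toFun x y| ≤ 1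

end BddKernel

/-! ### Step functions on the uniform partition -/

/-- The cells of the uniform partition of `[0,1]` into `K` intervals, numbered from `0`:
`[i/K, (i+1)/K)` for `i + 1 < K`, and the closed interval `[(K-1)/K, 1]` for `i + 1 = K`. -/
def cell (K : ℕ) (i : Fin K) : Set I :=
  {x | (i : ℝ) / K ≤ (x : ℝ) ∧ ((x : ℝ) < ((i : ℝ) + 1) / K ∨ (i : ℕ) + 1 = K)}

theorem measurableSet_cell (K : ℕ) (i : Fin K) : MeasurableSet (cell K i) := by
  refine (measurableSet_le measurable_const measurable_subtype_coe).inter ?_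
  exact (measurableSet_lt measurable_subtype_coe measurable_const).union
    (MeasurableSet.const _)

/-- The step function `∑ᵢ ∑ⱼ 1_{Pᵢ}(x) 1_{Pⱼ}(y) Mᵢⱼ` of a `K × K` matrix over the uniform
partition. -/
def stepKernel {K : ℕ} (M : Matrix (Fin K) (Fin K) ℝ) : BddKernel where
  toFun x y := ∑ i, ∑ j, (cell K i).indicator 1 x * (cell K j).indicator 1 y * M i j
  measurable_uncurry := by
    refine Finset.measurable_sum _ fun i _ => Finset.measurable_sum _ fun j _ => ?_
    refine Measurable.mul_const (Measurable.mul ?_ ?_) _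
    · exact (measurable_one.indicator (measurableSet_cell K i)).comp measurable_fst
    · exact (measurable_one.indicator (measurableSet_cell K j)).comp measurable_snd
  exists_bound := by
    refine ⟨∑ i, ∑ j, |M i j|, fun x y => ?_⟩
    have h01 : ∀ (i : Fin K) (z : I), |(cell K i).indicator (1 : I → ℝ) z| ≤ 1 := by
      intro i z
      by_cases hz : z ∈ cell K i <;> simp [hz]
    refine (Finset.abs_sum_le_sum_abs _ _).trans (Finset.sum_le_sum fun i _ => ?_)
    refine (Finset.abs_sum_le_sum_abs _ _).trans (Finset.sum_le_sum fun j _ => ?_)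
    rw [abs_mul, abs_mul]
    exact mul_le_of_le_one_left (abs_nonneg _)
      (mul_le_one₀ (h01 i x) (abs_nonneg _) (h01 j y))

/-- The indicator function of a cell, as an element of `L²[0,1]`. -/
def cellL2 (K : ℕ) (i : Fin K) : L2 :=
  indicatorConstLp 2 (measurableSet_cell K i) (measure_ne_top volume _) (1 : ℝ)

/-- The step function approximation of a bounded operator `P` over the uniform partition
`Q₁, …, Q_K`: the integral operator whose kernel equals
`⟪1_{Qᵢ}, P 1_{Qⱼ}⟫ / (μ(Qᵢ) μ(Qⱼ))` on `Qᵢ × Qⱼ`. -/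
def stepApprox (K : ℕ) (P : L2 →L[ℝ] L2) : L2 →L[ℝ] L2 :=
  (stepKernel (Matrix.of fun i j : Fin K =>
    ⟪cellL2 K i, P (cellL2 K j)⟫_ℝ /
      ((volume : Measure I).real (cell K i) * (volume : Measure I).real (cell K j)))).op

/-! ### Systems, Riccati equations, closed loops and costs -/

/-- The operator `a I + W` on `L²[0,1]`. -/
def sysOp (a : ℝ) (W : BddKernel) : L2 →L[ℝ] L2 :=
  a • ContinuousLinearMap.id ℝ L2 + W.op

/-- `x` is the mild solution on `[0,T]` of `ẋ = A x + B u` with initial state `x₀` and control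
`u ∈ L²([0,T]; L²[0,1])`. -/
structure IsMildSolution (T : ℝ) (A B : L2 →L[ℝ] L2) (x₀ : L2) (u x : ℝ → L2) : Prop where
  control_memLp : MemLp u 2 (volume.restrict (Icc 0 T))
  continuousOn : ContinuousOn x (Icc 0 T)
  initial : x 0 = x₀
  mild : ∀ a t : ℝ, 0 ≤ a → a ≤ t → t ≤ T →
    x t = NormedSpace.exp ((t - a) • A) (x a)
      + ∫ s in a..t, NormedSpace.exp ((t - s) • A) (B (u s))

/-- `P` is a solution on `[0,T]`, in the class of strongly continuous mappings into the Hermitian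
non-negative operators, of the Riccati equation
`Ṗ = Aᵀ P + P A - P B Bᵀ P + Cᵀ C` with initial value `P₀`. -/
structure IsRiccatiSolution (T : ℝ) (A B C P₀ : L2 →L[ℝ] L2) (P : ℝ → L2 →L[ℝ] L2) : Prop where
  nonneg : ∀ t ∈ Icc 0 T, (P t).IsPositive
  continuousOn : ∀ v, ContinuousOn (fun t => P t v) (Icc 0 T)
  initial : P 0 = P₀
  deriv : ∀ v, ∀ t ∈ Icc 0 T,
    HasDerivWithinAt (fun s => P s v)
      (((A†) ∘L P t + P t ∘L A - P t ∘L B ∘L (B†) ∘L P t + (C†) ∘L C) v) (Icc 0 T) t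

/-- `(u, x)` is the control and the trajectory of the system `(A; B)` started at `x₀` under the
linear feedback law `u_t = - Bᵀ P_{T-t} x_t`. -/
structure IsClosedLoop (T : ℝ) (A B : L2 →L[ℝ] L2) (P : ℝ → L2 →L[ℝ] L2) (x₀ : L2)
    (u x : ℝ → L2) : Prop where
  solution : IsMildSolution T A B x₀ u x
  feedback : ∀ t ∈ Icc 0 T, u t = -((B†) (P (T - t) (x t)))

/-- The linear quadratic cost `∫₀ᵀ (‖C x_t‖² + ‖u_t‖²) dt + ⟨P₀ x_T, x_T⟩` of a control `u` with
trajectory `x`. -/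
def cost (T : ℝ) (C P₀ : L2 →L[ℝ] L2) (u x : ℝ → L2) : ℝ :=
  (∫ t in (0 : ℝ)..T, (‖C (x t)‖ ^ 2 + ‖u t‖ ^ 2)) + ⟪P₀ (x T), x T⟫_ℝ

/-- The block adjacency matrices of networks: symmetric, with entries in `[-1,1]`. -/
def IsNetworkMatrix {K : ℕ} (M : Matrix (Fin K) (Fin K) ℝ) : Prop :=
  M.IsSymm ∧ ∀ i j, |M i j| ≤ 1

/-- Convergence of the operators `a_N I + W_N` to `a I + W`, where `W` is a graphon: the scalars
converge, and the graphon operators converge in operator norm. -/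
def SysOpConverges (a : ℕ → ℝ) (W : ℕ → BddKernel) (a' : ℝ) (W' : BddKernel) : Prop :=
  Tendsto a atTop (𝓝 a') ∧ W'.IsGraphon ∧ Tendsto (fun N => ‖W'.op - (W N).op‖) atTop (𝓝 0)

end GraphonLQR

end

/-! Neither closed loop is compared with the other directly, and optimality plays no role. Both
trajectories converge to the solution `y` of one limit equation, `ẏ = (𝔸 - 𝔹 𝔹ᵀ P_{T-t}) y`, and
both costs converge to the cost of this limit loop. By `closedLoop_tendsto` it is enough that the
feedback operators be uniformly bounded and converge strongly to `P_t` for each `t`.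

For the approximate feedback, the step function approximation is the compression `E P E` by the
orthogonal projection `E` onto step functions (`stepApprox_eq`), and `E` tends to the identity
strongly (`cellAverage_tendsto`).

For the optimal feedback, the Riccati solutions must be shown to converge (`riccati_tendsto`), but
only strongly, since the cost operators converge only strongly. The difference `D = P^N - P`
satisfies a linear equation with `D` multiplied from the left and from the right. A Grönwall
estimate of `D v` for a fixed `v` fails on the right factor. Evaluated along a curve `y` with `ẏ =
-(𝔸 - 𝔹 𝔹ᵀ P) y` and terminal value `v`, the right factor cancels, leaving a vector equation for `D
y` with a vanishing inhomogeneity. The uniform bound on `P^N` that this needs is the energy estimate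
`riccati_norm_le`. -/

noncomputable section

namespace GraphonLQR

/-! ### Linear differential equations and Grönwall estimates in normed spaces. -/

section LinearODE

variable {E : Type*} [NormedAddCommGroup E] [NormedSpace ℝ E]

/-- The terms of the Neumann series of the Volterra equation `y t = x₀ + ∫₀ᵗ L s (y s) ds`. -/
def volterraTerm (L : ℝ → E →L[ℝ] E) (x₀ : E) : ℕ → ℝ → E
  | 0 => fun _ => x₀
  | n + 1 => fun t => ∫ s in (0 : ℝ)..t, L s (volterraTerm L x₀ n s)

theorem continuous_volterraTerm {L : ℝ → E →L[ℝ] E} (hL : Continuous L) (x₀ : E) (n : ℕ) :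
    Continuous (volterraTerm L x₀ n) := by
  induction n with
  | zero => exact continuous_const
  | succ n ih =>
    exact intervalIntegral.continuous_primitive
      (fun a b => (hL.clm_apply ih).intervalIntegrable a b) 0

theorem norm_volterraTerm_le {L : ℝ → E →L[ℝ] E} (hL : Continuous L) {K : ℝ}
    (hK : ∀ t, ‖L t‖ ≤ K) (x₀ : E) (n : ℕ) (t : ℝ) :
    ‖volterraTerm L x₀ n t‖ ≤ ‖x₀‖ * ((K * |t|) ^ n / n.factorial) := by
  have hK0 : 0 ≤ K := (norm_nonneg _).trans (hK 0)
  induction n generalizing t with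
  | zero => simp [volterraTerm]
  | succ n ih =>
    have hi := integral_pow_abs_sub_uIoc (a := 0) (b := t) n
    simp only [sub_zero] at hi
    calc ‖volterraTerm L x₀ (n + 1) t‖
        ≤ ∫ s in uIoc 0 t, ‖L s (volterraTerm L x₀ n s)‖ :=
          intervalIntegral.norm_integral_le_integral_norm_uIoc
      _ ≤ ∫ s in uIoc 0 t, (‖x₀‖ * K ^ (n + 1) / n.factorial) * |s| ^ n := by
          refine setIntegral_mono_on ?_ ?_ measurableSet_uIoc fun s _ => ?_
          · exact ((hL.clm_apply (continuous_volterraTerm hL x₀ n)).norm).integrableOn_uIoc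
          · exact Continuous.integrableOn_uIoc (by fun_prop)
          · refine ((L s).le_opNorm _).trans ?_
            calc ‖L s‖ * ‖volterraTerm L x₀ n s‖
                ≤ K * (‖x₀‖ * ((K * |s|) ^ n / n.factorial)) :=
                  mul_le_mul (hK s) (ih s) (norm_nonneg _) hK0
              _ = _ := by rw [mul_pow, pow_succ]; ring
      _ = ‖x₀‖ * ((K * |t|) ^ (n + 1) / (n + 1).factorial) := by
          rw [integral_const_mul, hi, mul_pow, Nat.factorial_succ]
          push_cast
          field_simp

/-- The solution is the Neumann series. The factorial bounds allow termwise differentiation on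
bounded intervals, and differentiating the term `n + 1` gives `L` applied to the term `n`. -/
theorem exists_linear_ode_solution_of_continuous [CompleteSpace E] {L : ℝ → E →L[ℝ] E}
    (hL : Continuous L) {K : ℝ} (hK : ∀ t, ‖L t‖ ≤ K) (x₀ : E) :
    ∃ y : ℝ → E, y 0 = x₀ ∧ ∀ t, HasDerivAt y (L t (y t)) t := by
  have hK0 : 0 ≤ K := (norm_nonneg _).trans (hK 0)
  have hsum : ∀ t, Summable fun n => volterraTerm L x₀ n t := fun t =>
    .of_norm_bounded ((Real.summable_pow_div_factorial (K * |t|)).mul_left ‖x₀‖)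
      fun n => norm_volterraTerm_le hL hK x₀ n t
  refine ⟨fun t => ∑' n, volterraTerm L x₀ n t, ?_, fun t => ?_⟩
  · simp only [(hsum 0).tsum_eq_zero_add]
    simp [volterraTerm]
  · have hder : ∀ n y, HasDerivAt (fun s => volterraTerm L x₀ (n + 1) s)
        (L y (volterraTerm L x₀ n y)) y := fun n y =>
      (hL.clm_apply (continuous_volterraTerm hL x₀ n)).integral_hasStrictDerivAt 0 y |>.hasDerivAt
    have hR : t ∈ Metric.ball (0 : ℝ) (|t| + 1) := by simp
    have hmain := hasDerivAt_tsum_of_isPreconnected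
      (u := fun n => K * (‖x₀‖ * ((K * (|t| + 1)) ^ n / n.factorial)))
      (g := fun n s => volterraTerm L x₀ (n + 1) s)
      (((Real.summable_pow_div_factorial (K * (|t| + 1))).mul_left ‖x₀‖).mul_left K)
      Metric.isOpen_ball (convex_ball (0 : ℝ) (|t| + 1)).isPreconnected
      (fun n y _ => hder n y)
      (fun n y hy => by
        refine ((L y).le_opNorm _).trans (mul_le_mul (hK y)
          ((norm_volterraTerm_le hL hK x₀ n y).trans ?_) (norm_nonneg _) hK0)
        have : |y| ≤ |t| + 1 := by simpa using (Metric.mem_ball.1 hy).le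
        gcongr)
      hR ((summable_nat_add_iff 1).2 (hsum t)) hR
    have h1 : (fun s => ∑' n, volterraTerm L x₀ n s)
        = fun s => x₀ + ∑' n, volterraTerm L x₀ (n + 1) s := by
      funext s
      rw [(hsum s).tsum_eq_zero_add]
      rfl
    rw [h1]
    have h2 := hmain.const_add x₀
    rwa [← (L t).map_tsum (hsum t), (hsum t).tsum_eq_zero_add] at h2

/-- A linear differential equation with continuous coefficients has a global solution. -/
theorem exists_linear_ode_solution [CompleteSpace E] {L : ℝ → E →L[ℝ] E} {T : ℝ} (hT : 0 ≤ T)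
    (hL : ContinuousOn L (Icc 0 T)) (x₀ : E) :
    ∃ y : ℝ → E, y 0 = x₀ ∧ ∀ t ∈ Icc 0 T, HasDerivWithinAt y (L t (y t)) (Icc 0 T) t := by
  obtain ⟨K, hK⟩ := isCompact_Icc.exists_bound_of_continuousOn hL
  -- Freezing the coefficient at its endpoint values outside `[0,T]` makes it continuous and bounded
  -- on the whole line.
  obtain ⟨y, hy0, hy⟩ := exists_linear_ode_solution_of_continuous
    (L := IccExtend hT ((Icc 0 T).domRestrict L)) (K := K) hL.domRestrict.Icc_extend'
    (fun t => hK _ (projIcc 0 T hT t).2) x₀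
  refine ⟨y, hy0, fun t ht => ?_⟩
  have := (hy t).hasDerivWithinAt (s := Icc 0 T)
  rwa [IccExtend_of_mem hT _ ht] at this

/-- The terminal value problem for a linear differential equation. -/
theorem exists_linear_ode_solution_backward [CompleteSpace E] {L : ℝ → E →L[ℝ] E} {T : ℝ}
    (hT : 0 ≤ T) (hL : ContinuousOn L (Icc 0 T)) (v : E) :
    ∃ y : ℝ → E, y T = v ∧ ∀ t ∈ Icc 0 T, HasDerivWithinAt y (-L t (y t)) (Icc 0 T) t := by
  have hmaps : MapsTo (fun t => T - t) (Icc 0 T) (Icc 0 T) := fun t ht =>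
    ⟨by linarith [ht.2], by linarith [ht.1]⟩
  obtain ⟨z, hz0, hz⟩ := exists_linear_ode_solution hT
    (L := fun t => L (T - t)) (hL.comp (by fun_prop) hmaps) v
  refine ⟨fun t => z (T - t), by simpa using hz0, fun t ht => ?_⟩
  have h1 : HasDerivWithinAt (fun t : ℝ => T - t) (-1) (Icc 0 T) t := by
    simpa using (hasDerivWithinAt_id t (Icc 0 T)).const_sub T
  have h2 := (hz (T - t) (hmaps ht)).scomp t h1 hmaps
  simpa [Function.comp_def] using h2

/-- Comparison with an explicit supersolution. The comparison principle asks for a strict inequality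
of derivatives where the curves touch, so a slack `δ t` is added and then sent to zero. -/
theorem norm_le_of_norm_deriv_le_of_continuous {f f' : ℝ → E} {ε : ℝ → ℝ} {K T : ℝ}
    (hf : ∀ t ∈ Icc 0 T, HasDerivWithinAt f (f' t) (Icc 0 T) t) (hε : Continuous ε)
    (hε0 : ∀ t, 0 ≤ ε t) (hK : 0 ≤ K) (hb : ∀ t ∈ Icc 0 T, ‖f' t‖ ≤ K * ‖f t‖ + ε t) :
    ∀ t ∈ Icc 0 T, ‖f t‖ ≤ Real.exp (K * t) * (‖f 0‖ + ∫ s in (0 : ℝ)..t, ε s) := by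
  intro t ht
  have key : ∀ δ > 0, ‖f t‖ ≤ Real.exp (K * t) * (‖f 0‖ + δ * t + ∫ s in (0 : ℝ)..t, ε s) := by
    intro δ hδ
    have hB : ∀ x, HasDerivAt
        (fun x => Real.exp (K * x) * (‖f 0‖ + δ * x + ∫ s in (0 : ℝ)..x, ε s))
        (K * (Real.exp (K * x) * (‖f 0‖ + δ * x + ∫ s in (0 : ℝ)..x, ε s))
          + Real.exp (K * x) * (δ + ε x)) x := by
      intro x
      have h1 : HasDerivAt (fun x => Real.exp (K * x)) (Real.exp (K * x) * K) x := by
        simpa using ((hasDerivAt_id x).const_mul K).exp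
      have h2 : HasDerivAt (fun x => ∫ s in (0 : ℝ)..x, ε s) (ε x) x :=
        (hε.integral_hasStrictDerivAt 0 x).hasDerivAt
      have h3 : HasDerivAt (fun x => ‖f 0‖ + δ * x) δ x := by
        simpa using ((hasDerivAt_id x).const_mul δ).const_add ‖f 0‖
      convert! h1.mul (h3.add h2) using 1
      simp only [Pi.add_apply]
      ring
    refine image_norm_le_of_norm_deriv_right_lt_deriv_boundary (f := f) (f' := f') (a := 0) (b := T)
      (fun x hx => (hf x hx).continuousWithinAt)
      (fun x hx => ((hf x ⟨hx.1, hx.2.le⟩).mono_of_mem_nhdsWithin (Icc_mem_nhdsGE_of_mem hx)))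
      (by simp) hB (fun x hx hxe => ?_) ht
    refine (hb x ⟨hx.1, hx.2.le⟩).trans_lt ?_
    rw [← hxe]
    -- The exponential factor is at least one, so multiplying `δ + ε x` by it still strictly
    -- dominates `ε x`.
    have h1 : 1 ≤ Real.exp (K * x) := Real.one_le_exp (mul_nonneg hK hx.1)
    nlinarith [hε0 x]
  have hlim : Tendsto (fun δ : ℝ => Real.exp (K * t) * (‖f 0‖ + δ * t + ∫ s in (0 : ℝ)..t, ε s))
      (𝓝[>] 0) (𝓝 (Real.exp (K * t) * (‖f 0‖ + 0 * t + ∫ s in (0 : ℝ)..t, ε s))) := by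
    refine Tendsto.mono_left (Continuous.tendsto ?_ 0) nhdsWithin_le_nhds
    fun_prop
  have := ge_of_tendsto hlim (eventually_nhdsWithin_of_forall fun δ hδ => key δ hδ)
  simpa using this

/-- Grönwall's inequality with a time-dependent inhomogeneity. -/
theorem norm_le_of_norm_deriv_le {f f' : ℝ → E} {ε : ℝ → ℝ} {K T : ℝ} (hT : 0 ≤ T)
    (hf : ∀ t ∈ Icc 0 T, HasDerivWithinAt f (f' t) (Icc 0 T) t) (hε : ContinuousOn ε (Icc 0 T))
    (hε0 : ∀ t ∈ Icc 0 T, 0 ≤ ε t) (hK : 0 ≤ K)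
    (hb : ∀ t ∈ Icc 0 T, ‖f' t‖ ≤ K * ‖f t‖ + ε t) :
    ∀ t ∈ Icc 0 T, ‖f t‖ ≤ Real.exp (K * T) * (‖f 0‖ + ∫ s in (0 : ℝ)..T, ε s) := by
  intro t ht
  have heq : ∀ s ∈ Icc 0 T, IccExtend hT ((Icc 0 T).domRestrict ε) s = ε s := fun s hs =>
    IccExtend_of_mem hT _ hs
  have hcont : Continuous (IccExtend hT ((Icc 0 T).domRestrict ε)) := hε.domRestrict.Icc_extend'
  have hnn : ∀ s, 0 ≤ IccExtend hT ((Icc 0 T).domRestrict ε) s := fun s =>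
    hε0 _ (projIcc 0 T hT s).2
  have h := norm_le_of_norm_deriv_le_of_continuous hf hcont hnn hK
    (fun s hs => by rw [heq s hs]; exact hb s hs) t ht
  have hint : ∫ s in (0 : ℝ)..T, IccExtend hT ((Icc 0 T).domRestrict ε) s
      = ∫ s in (0 : ℝ)..T, ε s :=
    intervalIntegral.integral_congr fun s hs => heq s (by rwa [uIcc_of_le hT] at hs)
  rw [← hint]
  refine h.trans ?_
  have hmono : ∫ s in (0 : ℝ)..t, IccExtend hT ((Icc 0 T).domRestrict ε) s
      ≤ ∫ s in (0 : ℝ)..T, IccExtend hT ((Icc 0 T).domRestrict ε) s :=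
    intervalIntegral.integral_mono_interval le_rfl ht.1 ht.2
      (ae_of_all _ hnn) (hcont.intervalIntegrable 0 T)
  have h0 : 0 ≤ ∫ s in (0 : ℝ)..t, IccExtend hT ((Icc 0 T).domRestrict ε) s :=
    intervalIntegral.integral_nonneg ht.1 fun s _ => hnn s
  have := ht.2
  gcongr

/-- Asymptotic form of Grönwall's inequality: perturbations that vanish pointwise and boundedly
have a uniformly vanishing effect. -/
theorem exists_tendsto_zero_of_norm_deriv_le {f f' : ℕ → ℝ → E} {ε : ℕ → ℝ → ℝ} {K M T : ℝ}
    (hT : 0 ≤ T) (hK : 0 ≤ K)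
    (hf : ∀ᶠ N in atTop, ∀ t ∈ Icc 0 T, HasDerivWithinAt (f N) (f' N t) (Icc 0 T) t)
    (hε : ∀ᶠ N in atTop, ContinuousOn (ε N) (Icc 0 T))
    (hεb : ∀ᶠ N in atTop, ∀ t ∈ Icc 0 T, 0 ≤ ε N t ∧ ε N t ≤ M)
    (hεlim : ∀ t ∈ Icc 0 T, Tendsto (fun N => ε N t) atTop (𝓝 0))
    (h0 : Tendsto (fun N => f N 0) atTop (𝓝 0))
    (hb : ∀ᶠ N in atTop, ∀ t ∈ Icc 0 T, ‖f' N t‖ ≤ K * ‖f N t‖ + ε N t) :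
    ∃ b : ℕ → ℝ, Tendsto b atTop (𝓝 0) ∧ ∀ᶠ N in atTop, ∀ t ∈ Icc 0 T, ‖f N t‖ ≤ b N := by
  refine ⟨fun N => Real.exp (K * T) * (‖f N 0‖ + ∫ s in (0 : ℝ)..T, ε N s), ?_, ?_⟩
  · have hsub : ∀ {s}, s ∈ uIoc 0 T → s ∈ Icc 0 T := fun hs => by
      rw [uIoc_of_le hT] at hs
      exact ⟨hs.1.le, hs.2⟩
    have hint : Tendsto (fun N => ∫ s in (0 : ℝ)..T, ε N s) atTop
        (𝓝 (∫ _ in (0 : ℝ)..T, (0 : ℝ))) := by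
      refine intervalIntegral.tendsto_integral_filter_of_dominated_convergence (fun _ => M) ?_ ?_
        intervalIntegrable_const (ae_of_all _ fun s hs => hεlim s (hsub hs))
      · filter_upwards [hε] with N hN
        exact (hN.mono fun s hs => hsub hs).aestronglyMeasurable measurableSet_uIoc
      · filter_upwards [hεb] with N hN
        refine ae_of_all _ fun s hs => ?_
        rw [Real.norm_of_nonneg (hN s (hsub hs)).1]
        exact (hN s (hsub hs)).2
    have := (h0.norm.add hint).const_mul (Real.exp (K * T))
    simpa using this
  · filter_upwards [hf, hε, hεb, hb] with N h1 h2 h3 h4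
    exact norm_le_of_norm_deriv_le hT h1 h2 (fun t ht => (h3 t ht).1) hK h4

/-- The mean value inequality gives each `P · v` the Lipschitz constant `M * ‖v‖`; being
proportional to `‖v‖`, it yields a Lipschitz bound in operator norm. -/
theorem continuousOn_of_strong_deriv {P F : ℝ → E →L[ℝ] E} {T M : ℝ}
    (hP : ∀ v, ∀ t ∈ Icc 0 T, HasDerivWithinAt (fun s => P s v) (F t v) (Icc 0 T) t)
    (hM : ∀ t ∈ Icc 0 T, ‖F t‖ ≤ M) : ContinuousOn P (Icc 0 T) := by
  rcases lt_or_ge T 0 with hT | hT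
  · simp [Icc_eq_empty (not_le.2 hT)]
  have hM0 : 0 ≤ M := (norm_nonneg _).trans (hM 0 ⟨le_rfl, hT⟩)
  refine (LipschitzOnWith.of_dist_le_mul (K := M.toNNReal) fun s hs t ht => ?_).continuousOn
  rw [dist_eq_norm, dist_eq_norm, Real.coe_toNNReal _ hM0]
  refine ContinuousLinearMap.opNorm_le_bound _ (by positivity) fun v => ?_
  have := (convex_Icc 0 T).norm_image_sub_le_of_norm_hasDerivWithin_le (hP v)
    (C := M * ‖v‖) (fun x hx => ((F x).le_opNorm v).trans (by gcongr; exact hM x hx)) ht hs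
  calc ‖(P s - P t) v‖ = ‖P s v - P t v‖ := rfl
    _ ≤ M * ‖v‖ * ‖s - t‖ := this
    _ = _ := by ring

/-- A pointwise derivative that is continuous in operator norm is a derivative in operator
norm. -/
theorem hasDerivWithinAt_of_strong_deriv {P F : ℝ → E →L[ℝ] E} {T : ℝ}
    (hP : ∀ v, ∀ t ∈ Icc 0 T, HasDerivWithinAt (fun s => P s v) (F t v) (Icc 0 T) t)
    (hF : ContinuousOn F (Icc 0 T)) {t : ℝ} (ht : t ∈ Icc 0 T) :
    HasDerivWithinAt P (F t) (Icc 0 T) t := by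
  rw [hasDerivWithinAt_iff_isLittleO, Asymptotics.isLittleO_iff]
  intro c hc
  obtain ⟨δ, hδ, hδF⟩ := Metric.continuousWithinAt_iff.1 (hF t ht) c hc
  have hmem : Icc 0 T ∩ Metric.ball t δ ∈ 𝓝[Icc 0 T] t :=
    inter_mem self_mem_nhdsWithin (mem_nhdsWithin_of_mem_nhds (Metric.ball_mem_nhds t hδ))
  filter_upwards [hmem] with s hs
  refine ContinuousLinearMap.opNorm_le_bound _ (by positivity) fun v => ?_
  -- Once the linear part at `t` is removed, the derivative is at most `c * ‖v‖` near `t`. The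
  -- radius `δ` does not depend on `v`, which makes the estimate one in operator norm.
  have hd : ∀ x ∈ Icc 0 T ∩ Metric.ball t δ, HasDerivWithinAt
      (fun x => P x v - (x - t) • F t v) (F x v - F t v) (Icc 0 T ∩ Metric.ball t δ) x := by
    intro x hx
    have h1 := (hP v x hx.1).mono (inter_subset_left (t := Metric.ball t δ))
    have h2 : HasDerivWithinAt (fun x : ℝ => (x - t) • F t v) ((1 : ℝ) • F t v)
        (Icc 0 T ∩ Metric.ball t δ) x :=
      ((hasDerivWithinAt_id x _).sub_const t).smul_const (F t v)
    simpa [Pi.sub_def] using h1.sub h2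
  have := ((convex_Icc 0 T).inter (convex_ball t δ)).norm_image_sub_le_of_norm_hasDerivWithin_le
    hd (C := c * ‖v‖) (fun x hx => by
      have h3 : ‖F x - F t‖ ≤ c := by
        rw [← dist_eq_norm]; exact (hδF hx.1 (Metric.mem_ball.1 hx.2)).le
      exact ((F x - F t).le_opNorm v).trans (by gcongr)) ⟨ht, Metric.mem_ball_self hδ⟩ hs
  calc ‖(P s - P t - (s - t) • F t) v‖
      = ‖P s v - (s - t) • F t v - (P t v - (t - t) • F t v)‖ := by
        simp only [sub_apply, smul_apply, sub_self,
          zero_smul, sub_zero]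
        congr 1
        abel
    _ ≤ c * ‖v‖ * ‖s - t‖ := this
    _ = _ := by ring

end LinearODE

/-! ### The Riccati equation: regularity, a priori bound and strong stability. -/

section Riccati

variable {H : Type*} [NormedAddCommGroup H] [InnerProductSpace ℝ H]

/-- The uniform norm bound absorbs the motion of the argument; strong convergence is then only
needed at the limit point. -/
theorem tendsto_apply_of_strong {P : ℕ → H →L[ℝ] H} {Q : H →L[ℝ] H} {M : ℝ}
    (hP : ∀ v, Tendsto (fun N => P N v) atTop (𝓝 (Q v))) (hM : ∀ᶠ N in atTop, ‖P N‖ ≤ M)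
    {x : ℕ → H} {y : H} (hx : Tendsto x atTop (𝓝 y)) :
    Tendsto (fun N => P N (x N)) atTop (𝓝 (Q y)) := by
  have h1 : Tendsto (fun N => P N (x N - y)) atTop (𝓝 0) := by
    refine squeeze_zero_norm' (a := fun N => M * ‖x N - y‖) ?_ ?_
    · filter_upwards [hM] with N hN
      exact ((P N).le_opNorm _).trans (by gcongr)
    · have := (tendsto_iff_norm_sub_tendsto_zero.1 hx).const_mul M
      simpa using this
  have h2 := h1.add (hP y)
  simpa using h2

/-- Polarization: for unit vectors `v` and `w`, with `w` in the direction of `P v`, `4 ‖P v‖` is the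
quadratic form at `v + w` minus that at `v - w`. The second is nonnegative and the first is at most
`4 c`. -/
theorem norm_le_of_isPositive {P : H →L[ℝ] H} (hP : P.IsPositive) {c : ℝ} (hc : 0 ≤ c)
    (h : ∀ v, ⟪P v, v⟫_ℝ ≤ c * ‖v‖ ^ 2) : ‖P‖ ≤ c := by
  refine ContinuousLinearMap.opNorm_le_of_unit_norm hc fun v hv => ?_
  rcases eq_or_ne (P v) 0 with h0 | h0
  · simpa [h0] using hc
  have hpos : 0 < ‖P v‖ := norm_pos_iff.2 h0
  set w : H := ‖P v‖⁻¹ • P v with hw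
  have hwn : ‖w‖ = 1 := norm_smul_inv_norm h0
  have hvw : ⟪P v, w⟫_ℝ = ‖P v‖ := by
    rw [hw, inner_smul_right, real_inner_self_eq_norm_sq]
    field_simp
  have hwv : ⟪P w, v⟫_ℝ = ‖P v‖ := by
    rw [hP.inner_left_eq_inner_right, real_inner_comm, hvw]
  have h1 := h (v + w)
  have h2 : 0 ≤ ⟪P (v - w), v - w⟫_ℝ := hP.inner_nonneg_left _
  simp only [map_add, map_sub, inner_add_left, inner_add_right, inner_sub_left, inner_sub_right,
    hvw, hwv] at h1 h2
  have h3 : ‖v + w‖ ≤ 2 := (norm_add_le _ _).trans (by rw [hv, hwn]; norm_num)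
  have h4 : ‖v + w‖ ^ 2 ≤ 4 := by nlinarith [norm_nonneg (v + w)]
  nlinarith [mul_le_mul_of_nonneg_left h4 hc]

variable [CompleteSpace H]

/-- The right-hand side `Aᵀ P + P A - P B Bᵀ P + Cᵀ C` of the Riccati equation. -/
def riccatiField (A B C P : H →L[ℝ] H) : H →L[ℝ] H :=
  (A†) ∘L P + P ∘L A - P ∘L B ∘L (B†) ∘L P + (C†) ∘L C

theorem exists_norm_le_of_strongly_continuous {P : ℝ → H →L[ℝ] H} {T : ℝ}
    (hP : ∀ v, ContinuousOn (fun t => P t v) (Icc 0 T)) : ∃ M, ∀ t ∈ Icc 0 T, ‖P t‖ ≤ M := by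
  obtain ⟨M, hM⟩ := banach_steinhaus (g := fun t : Icc 0 T => P t) fun v => by
    obtain ⟨c, hc⟩ := isCompact_Icc.exists_bound_of_continuousOn (hP v)
    exact ⟨c, fun t => hc t t.2⟩
  exact ⟨M, fun t ht => hM ⟨t, ht⟩⟩

theorem exists_norm_le_of_tendsto {P : ℕ → H →L[ℝ] H} {Q : H →L[ℝ] H}
    (hP : ∀ v, Tendsto (fun N => P N v) atTop (𝓝 (Q v))) : ∃ M, ∀ N, ‖P N‖ ≤ M :=
  banach_steinhaus fun v => by
    obtain ⟨c, hc⟩ := (hP v).norm.bddAbove_range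
    exact ⟨c, fun N => hc ⟨N, rfl⟩⟩

theorem continuous_riccatiField (A B C : H →L[ℝ] H) : Continuous (riccatiField A B C) := by
  unfold riccatiField
  fun_prop

/-- Strong continuity on a compact interval gives a norm bound by Banach–Steinhaus, hence a bound on
the Riccati field, hence a Lipschitz estimate. -/
theorem riccati_continuousOn {A B C : H →L[ℝ] H} {P : ℝ → H →L[ℝ] H} {T : ℝ}
    (hc : ∀ v, ContinuousOn (fun t => P t v) (Icc 0 T))
    (hd : ∀ v, ∀ t ∈ Icc 0 T,
      HasDerivWithinAt (fun s => P s v) (riccatiField A B C (P t) v) (Icc 0 T) t) :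
    ContinuousOn P (Icc 0 T) := by
  obtain ⟨M, hM⟩ := exists_norm_le_of_strongly_continuous hc
  refine continuousOn_of_strong_deriv hd (M := ‖A†‖ * M + M * ‖A‖ + M * (‖B‖ * (‖B†‖ * M))
    + ‖(C†) ∘L C‖) fun t ht => ?_
  have hMt := hM t ht
  have hM0 : 0 ≤ M := (norm_nonneg _).trans hMt
  unfold riccatiField
  refine (norm_add_le _ _).trans (add_le_add ((norm_sub_le _ _).trans (add_le_add
    ((norm_add_le _ _).trans (add_le_add ?_ ?_)) ?_)) le_rfl)
  · exact (ContinuousLinearMap.opNorm_comp_le _ _).trans (by gcongr)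
  · exact (ContinuousLinearMap.opNorm_comp_le _ _).trans (by gcongr)
  · refine (ContinuousLinearMap.opNorm_comp_le _ _).trans (mul_le_mul hMt ?_ (norm_nonneg _) hM0)
    refine (ContinuousLinearMap.opNorm_comp_le _ _).trans
      (mul_le_mul_of_nonneg_left ?_ (norm_nonneg _))
    exact (ContinuousLinearMap.opNorm_comp_le _ _).trans (by gcongr)

/-- Upgrading to a derivative in operator norm makes the product rule available for `P s (y s)` with
a moving vector `y s`. -/
theorem riccati_hasDerivWithinAt {A B C : H →L[ℝ] H} {P : ℝ → H →L[ℝ] H} {T : ℝ}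
    (hc : ∀ v, ContinuousOn (fun t => P t v) (Icc 0 T))
    (hd : ∀ v, ∀ t ∈ Icc 0 T,
      HasDerivWithinAt (fun s => P s v) (riccatiField A B C (P t) v) (Icc 0 T) t) :
    ∀ t ∈ Icc 0 T, HasDerivWithinAt P (riccatiField A B C (P t)) (Icc 0 T) t := fun _ ht =>
  hasDerivWithinAt_of_strong_deriv hd
    ((continuous_riccatiField A B C).comp_continuousOn (riccati_continuousOn hc hd)) ht

theorem hasDerivAt_exp_smul_apply (A : H →L[ℝ] H) (v : H) (t : ℝ) :
    HasDerivAt (fun s : ℝ => NormedSpace.exp (s • A) v) (A (NormedSpace.exp (t • A) v)) t := by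
  have h := hasDerivAt_exp_smul_const' (𝕂 := ℝ) A t
  simpa using h.clm_apply (hasDerivAt_const t v)

theorem norm_exp_smul_apply_le (A : H →L[ℝ] H) {s T : ℝ} (hs : 0 ≤ s) (hsT : s ≤ T) (v : H) :
    ‖NormedSpace.exp (s • A) v‖ ≤ Real.exp (T * ‖A‖) * ‖v‖ := by
  have h := norm_le_of_norm_deriv_le (ε := fun _ => 0) (K := ‖A‖) (hs.trans hsT)
    (fun t _ => (hasDerivAt_exp_smul_apply A v t).hasDerivWithinAt) continuousOn_const
    (fun _ _ => le_rfl) (norm_nonneg A) (fun t _ => by simpa using A.le_opNorm _) s ⟨hs, hsT⟩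
  simpa [mul_comm T] using h

/-- The energy estimate for the Riccati equation, from the cost of the zero control. -/
theorem riccati_norm_le {A B C : H →L[ℝ] H} {P : ℝ → H →L[ℝ] H} {T : ℝ} (hT : 0 ≤ T)
    (hpos : ∀ t ∈ Icc 0 T, (P t).IsPositive)
    (hd : ∀ t ∈ Icc 0 T, HasDerivWithinAt P (riccatiField A B C (P t)) (Icc 0 T) t) :
    ∀ t ∈ Icc 0 T, ‖P t‖ ≤ (‖P 0‖ + T * ‖C‖ ^ 2) * Real.exp (T * ‖A‖) ^ 2 := by
  intro t ht
  refine norm_le_of_isPositive (hpos t ht) (by positivity) fun v => ?_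
  -- The uncontrolled trajectory in reversed time, arriving at `v` when `s = t`. Along it the
  -- quadratic form of `P` has derivative `‖C y‖² - ‖B† P y‖²`, whose negative term is dropped.
  set y : ℝ → H := fun s => NormedSpace.exp ((t - s) • A) v with hy
  have hyd : ∀ s, HasDerivAt y (-A (y s)) s := by
    intro s
    have h1 : HasDerivAt (fun s : ℝ => t - s) (-1) s := by
      simpa using (hasDerivAt_id s).const_sub t
    have h2 := (hasDerivAt_exp_smul_apply A v (t - s)).scomp s h1
    simpa [Function.comp_def] using h2
  have hyn : ∀ s ∈ Icc 0 t, ‖y s‖ ≤ Real.exp (T * ‖A‖) * ‖v‖ := fun s hs =>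
    norm_exp_smul_apply_le A (by linarith [hs.2]) (by linarith [hs.1, ht.2]) v
  have hyt : y t = v := by simp [hy]
  have hsub : Icc 0 t ⊆ Icc 0 T := Icc_subset_Icc_right ht.2
  have hq : ∀ s ∈ Icc 0 t, HasDerivWithinAt (fun s => ⟪P s (y s), y s⟫_ℝ)
      (‖C (y s)‖ ^ 2 - ‖(B†) (P s (y s))‖ ^ 2) (Icc 0 t) s := by
    intro s hs
    have h1 := ((hd s (hsub hs)).mono hsub).clm_apply (hyd s).hasDerivWithinAt
    have h2 := h1.inner ℝ (hyd s).hasDerivWithinAt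
    refine h2.congr_deriv ?_
    have hsym := (hpos s (hsub hs)).inner_left_eq_inner_right
    have e1 : ⟪(P s) (B ((B†) (P s (y s)))), y s⟫_ℝ = ‖(B†) (P s (y s))‖ ^ 2 := by
      rw [hsym, real_inner_comm, ← ContinuousLinearMap.adjoint_inner_left,
        real_inner_self_eq_norm_sq]
    have e2 : ⟪(C†) (C (y s)), y s⟫_ℝ = ‖C (y s)‖ ^ 2 := by
      rw [ContinuousLinearMap.adjoint_inner_left, real_inner_self_eq_norm_sq]
    have e3 : ⟪(A†) (P s (y s)), y s⟫_ℝ = ⟪P s (y s), A (y s)⟫_ℝ :=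
      ContinuousLinearMap.adjoint_inner_left _ _ _
    simp only [riccatiField, add_apply, sub_apply, ContinuousLinearMap.comp_apply, inner_add_left,
      inner_sub_left, e1, e2, e3, map_neg, inner_neg_left, inner_neg_right]
    ring
  have hbound := image_le_of_deriv_right_le_deriv_boundary
    (f := fun s => ⟪P s (y s), y s⟫_ℝ) (a := 0) (b := t)
    (f' := fun s => ‖C (y s)‖ ^ 2 - ‖(B†) (P s (y s))‖ ^ 2)
    (B := fun s => ‖P 0‖ * (Real.exp (T * ‖A‖) * ‖v‖) ^ 2
      + (‖C‖ * (Real.exp (T * ‖A‖) * ‖v‖)) ^ 2 * s)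
    (B' := fun _ => (‖C‖ * (Real.exp (T * ‖A‖) * ‖v‖)) ^ 2)
    (fun s hs => (hq s hs).continuousWithinAt)
    (fun s hs => (hq s ⟨hs.1, hs.2.le⟩).mono_of_mem_nhdsWithin (Icc_mem_nhdsGE_of_mem hs))
    (by
      have h0 := hyn 0 ⟨le_rfl, ht.1⟩
      calc ⟪P 0 (y 0), y 0⟫_ℝ ≤ ‖P 0 (y 0)‖ * ‖y 0‖ := real_inner_le_norm _ _
        _ ≤ ‖P 0‖ * ‖y 0‖ * ‖y 0‖ := by gcongr; exact (P 0).le_opNorm _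
        _ = ‖P 0‖ * ‖y 0‖ ^ 2 := by ring
        _ ≤ _ := by simp only [mul_zero, add_zero]; gcongr)
    (by fun_prop)
    (fun s _ => by
      have h1 := ((hasDerivAt_id' s).const_mul
        ((‖C‖ * (Real.exp (T * ‖A‖) * ‖v‖)) ^ 2)).const_add
        (‖P 0‖ * (Real.exp (T * ‖A‖) * ‖v‖) ^ 2)
      rw [mul_one] at h1
      exact h1.hasDerivWithinAt)
    (fun s hs => by
      have h0 := hyn s ⟨hs.1, hs.2.le⟩
      have h1 : ‖C (y s)‖ ≤ ‖C‖ * (Real.exp (T * ‖A‖) * ‖v‖) :=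
        (C.le_opNorm _).trans (by gcongr)
      have h2 : ‖C (y s)‖ ^ 2 ≤ (‖C‖ * (Real.exp (T * ‖A‖) * ‖v‖)) ^ 2 := by gcongr
      have h3 := sq_nonneg ‖(B†) (P s (y s))‖
      linarith)
    (right_mem_Icc.2 ht.1)
  simp only [hyt] at hbound
  refine hbound.trans ?_
  have h4 : (‖C‖ * (Real.exp (T * ‖A‖) * ‖v‖)) ^ 2 * t
      ≤ (‖C‖ * (Real.exp (T * ‖A‖) * ‖v‖)) ^ 2 * T := by
    have := ht.2
    gcongr
  calc _ ≤ ‖P 0‖ * (Real.exp (T * ‖A‖) * ‖v‖) ^ 2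
      + (‖C‖ * (Real.exp (T * ‖A‖) * ‖v‖)) ^ 2 * T := by gcongr
    _ = _ := by ring

/-- The term added on the left is what the product rule contributes when `P' - P` is applied to a
curve with `ẏ = -(A - B B† P) y`. On the right, the first product acts from the left on the
difference, which suits Grönwall; every other summand contains a difference of coefficients. -/
theorem riccatiField_sub (A' B' C' P' A B C P : H →L[ℝ] H) :
    riccatiField A' B' C' P' - riccatiField A B C P + (P' - P) ∘L (-(A - B ∘L (B†) ∘L P))
      = ((A'†) - P' ∘L B' ∘L (B'†)) ∘L (P' - P)
        + ((P' - P) ∘L ((A' - A) - (B' ∘L (B'†) - B ∘L (B†)) ∘L P) + ((A'†) - (A†)) ∘L P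
          + P ∘L (A' - A) - P ∘L (B' ∘L (B'†) - B ∘L (B†)) ∘L P
          + ((C'†) ∘L C' - (C†) ∘L C)) := by
  ext v
  simp only [riccatiField, add_apply, sub_apply, neg_apply, ContinuousLinearMap.comp_apply,
    map_sub, map_neg]
  abel

/-- Strong convergence of the solutions of Riccati equations. -/
theorem riccati_tendsto {AN BN CN : ℕ → H →L[ℝ] H} {A B C : H →L[ℝ] H}
    {PN : ℕ → ℝ → H →L[ℝ] H} {P : ℝ → H →L[ℝ] H} {T M : ℝ}
    (hA : Tendsto AN atTop (𝓝 A)) (hB : Tendsto BN atTop (𝓝 B))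
    (hQ : ∀ v, Tendsto (fun N => ((CN N)†) (CN N v)) atTop (𝓝 ((C†) (C v))))
    (hPN : ∀ᶠ N in atTop, ∀ t ∈ Icc 0 T, HasDerivWithinAt (PN N)
      (riccatiField (AN N) (BN N) (CN N) (PN N t)) (Icc 0 T) t)
    (hP : ∀ t ∈ Icc 0 T, HasDerivWithinAt P (riccatiField A B C (P t)) (Icc 0 T) t)
    (hMN : ∀ᶠ N in atTop, ∀ t ∈ Icc 0 T, ‖PN N t‖ ≤ M) (hM : ∀ t ∈ Icc 0 T, ‖P t‖ ≤ M)
    (h0 : ∀ v, Tendsto (fun N => PN N 0 v) atTop (𝓝 (P 0 v))) :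
    ∀ t ∈ Icc 0 T, ∀ v, Tendsto (fun N => PN N t v) atTop (𝓝 (P t v)) := by
  intro t ht v
  have hsub : Icc 0 t ⊆ Icc 0 T := Icc_subset_Icc_right ht.2
  have hM0 : 0 ≤ M := (norm_nonneg _).trans (hM t ht)
  have hPc : ContinuousOn P (Icc 0 t) := fun s hs =>
    ((hP s (hsub hs)).continuousWithinAt).mono hsub
  -- This curve does not depend on `N`, so a strongly vanishing perturbation vanishes along it.
  obtain ⟨y, hyt, hy⟩ := exists_linear_ode_solution_backward ht.1
    (L := fun s => A - B ∘L (B†) ∘L P s) (by fun_prop) v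
  have hyc : ContinuousOn y (Icc 0 t) := fun s hs => (hy s hs).continuousWithinAt
  obtain ⟨Y, hY⟩ := isCompact_Icc.exists_bound_of_continuousOn hyc
  set S := B ∘L (B†) with hS
  set SN := fun N => BN N ∘L ((BN N)†) with hSN
  have hA' : Tendsto (fun N => ((AN N)†)) atTop (𝓝 (A†)) :=
    ((ContinuousLinearMap.adjoint (𝕜 := ℝ) (E := H) (F := H)).continuous.tendsto A).comp hA
  have hB' : Tendsto (fun N => ((BN N)†)) atTop (𝓝 (B†)) :=
    ((ContinuousLinearMap.adjoint (𝕜 := ℝ) (E := H) (F := H)).continuous.tendsto B).comp hB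
  have hSlim : Tendsto SN atTop (𝓝 S) := 
    ((continuous_fst.clm_comp continuous_snd).tendsto (B, (B†))).comp (hB.prodMk_nhds hB')
  set QN := fun N => ((CN N)†) ∘L CN N - (C†) ∘L C with hQN
  have hQlim : ∀ w, Tendsto (fun N => QN N w) atTop (𝓝 ((0 : H →L[ℝ] H) w)) := fun w => by
    simpa [hQN] using (hQ w).sub_const ((C†) (C w))
  obtain ⟨q, hq⟩ := exists_norm_le_of_tendsto hQlim
  have hq0 : 0 ≤ q := (norm_nonneg _).trans (hq 0)
  -- All errors that vanish in operator norm are collected here. `QN` vanishes only strongly and is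
  -- kept apart, applied to `y s`.
  set c : ℕ → ℝ := fun N => (M + M) * (‖AN N - A‖ + ‖SN N - S‖ * M) + ‖((AN N)†) - (A†)‖ * M
    + M * ‖AN N - A‖ + M * (‖SN N - S‖ * M) with hc
  have hc0 : ∀ N, 0 ≤ c N := fun N => by positivity
  have hclim : Tendsto c atTop (𝓝 0) := by
    have a1 := tendsto_iff_norm_sub_tendsto_zero.1 hA
    have a2 := tendsto_iff_norm_sub_tendsto_zero.1 hA'
    have a3 := tendsto_iff_norm_sub_tendsto_zero.1 hSlim
    have := ((((a1.add (a3.mul_const M)).const_mul (M + M)).add (a2.mul_const M)).add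
      (a1.const_mul M)).add ((a3.mul_const M).const_mul M)
    simpa using this
  have key : ∃ b : ℕ → ℝ, Tendsto b atTop (𝓝 0) ∧
      ∀ᶠ N in atTop, ∀ s ∈ Icc 0 t, ‖(PN N s - P s) (y s)‖ ≤ b N := by
    refine exists_tendsto_zero_of_norm_deriv_le (T := t) ht.1
      (f := fun N s => (PN N s - P s) (y s))
      (f' := fun N s => (riccatiField (AN N) (BN N) (CN N) (PN N s) - riccatiField A B C (P s)
        + (PN N s - P s) ∘L (-(A - B ∘L (B†) ∘L P s))) (y s))
      (ε := fun N s => c N * ‖y s‖ + ‖QN N (y s)‖) (K := ‖A†‖ + M * ‖S‖ + 1) (M := Y + q * Y)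
      (by positivity) ?_ ?_ ?_ ?_ ?_ ?_
    · filter_upwards [hPN] with N hN s hs
      have h1 := (((hN s (hsub hs)).sub (hP s (hsub hs))).mono hsub).clm_apply (hy s hs)
      refine h1.congr_deriv ?_
      simp only [add_apply, sub_apply, neg_apply, ContinuousLinearMap.comp_apply, Pi.sub_apply,
        map_neg, map_sub]
    · filter_upwards with N
      fun_prop
    -- Eventually `c N ≤ 1`, whence the dominating constant `Y + q * Y`.
    · filter_upwards [hclim.eventually (ge_mem_nhds zero_lt_one)] with N hN s hs
      have h1 := hY s hs
      refine ⟨by have := hc0 N; positivity, add_le_add ?_ (((QN N).le_opNorm _).trans ?_)⟩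
      · calc c N * ‖y s‖ ≤ 1 * Y := by gcongr
          _ = Y := one_mul Y
      · have := hq N
        gcongr
    · intro s _
      have := (hclim.mul_const ‖y s‖).add (hQlim (y s)).norm
      simpa using this
    · have := (h0 (y 0)).sub_const (P 0 (y 0))
      simpa using this
    · have hK : Tendsto (fun N => ‖((AN N)†)‖ + M * ‖SN N‖) atTop (𝓝 (‖A†‖ + M * ‖S‖)) :=
        hA'.norm.add (hSlim.norm.const_mul M)
      filter_upwards [hMN, hK.eventually (ge_mem_nhds (lt_add_one _))] with N hN hKN s hs
      have hN' := hN s (hsub hs)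
      have hMs := hM s (hsub hs)
      have hD : ‖PN N s - P s‖ ≤ M + M := (norm_sub_le _ _).trans (add_le_add hN' hMs)
      have hcomp : ∀ X Z : H →L[ℝ] H, ‖X ∘L Z‖ ≤ ‖X‖ * ‖Z‖ := ContinuousLinearMap.opNorm_comp_le
      have e1 : ‖((AN N)†) - PN N s ∘L SN N‖ ≤ ‖A†‖ + M * ‖S‖ + 1 :=
        (norm_sub_le _ _).trans ((add_le_add le_rfl ((hcomp _ _).trans (by gcongr))).trans hKN)
      have e2 : ‖(PN N s - P s) ∘L ((AN N - A) - (SN N - S) ∘L P s) + (((AN N)†) - (A†)) ∘L P s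
          + P s ∘L (AN N - A) - P s ∘L (SN N - S) ∘L P s‖ ≤ c N := by
        refine (norm_sub_le _ _).trans (add_le_add ((norm_add_le _ _).trans (add_le_add
          ((norm_add_le _ _).trans (add_le_add ((hcomp _ _).trans ?_) ((hcomp _ _).trans ?_)))
          ((hcomp _ _).trans ?_))) ((hcomp _ _).trans ?_))
        · gcongr
          exact (norm_sub_le _ _).trans (add_le_add le_rfl ((hcomp _ _).trans (by gcongr)))
        · gcongr
        · gcongr
        · gcongr
          exact (hcomp _ _).trans (by gcongr)
      rw [riccatiField_sub, add_apply, add_apply]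
      refine (norm_add_le _ _).trans (add_le_add ?_ ((norm_add_le _ _).trans (add_le_add ?_ le_rfl)))
      · exact (ContinuousLinearMap.le_opNorm _ ((PN N s - P s) (y s))).trans
          (mul_le_mul_of_nonneg_right e1 (norm_nonneg _))
      · exact (ContinuousLinearMap.le_opNorm _ _).trans
          (mul_le_mul_of_nonneg_right e2 (norm_nonneg _))
  obtain ⟨b, hb, hbound⟩ := key
  rw [tendsto_iff_norm_sub_tendsto_zero]
  refine squeeze_zero_norm' ?_ hb
  filter_upwards [hbound] with N hN
  simpa [hyt] using hN t ⟨ht.1, le_rfl⟩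

end Riccati

/-! ### Closed loops: from mild solutions to convergence of trajectories and costs. -/

section ClosedLoop

variable {H : Type*} [NormedAddCommGroup H] [InnerProductSpace ℝ H]

/-- Convergence of the solutions of linear differential equations with strongly convergent
coefficients. -/
theorem linear_ode_tendsto {LN : ℕ → ℝ → H →L[ℝ] H} {L : ℝ → H →L[ℝ] H} {xN : ℕ → ℝ → H}
    {y : ℝ → H} {T K : ℝ} (hT : 0 ≤ T)
    (hLN : ∀ᶠ N in atTop, ContinuousOn (LN N) (Icc 0 T)) (hL : ContinuousOn L (Icc 0 T))
    (hK : ∀ᶠ N in atTop, ∀ t ∈ Icc 0 T, ‖LN N t‖ ≤ K)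
    (hlim : ∀ t ∈ Icc 0 T, ∀ v, Tendsto (fun N => LN N t v) atTop (𝓝 (L t v)))
    (hxN : ∀ᶠ N in atTop, ∀ t ∈ Icc 0 T, HasDerivWithinAt (xN N) (LN N t (xN N t)) (Icc 0 T) t)
    (hy : ∀ t ∈ Icc 0 T, HasDerivWithinAt y (L t (y t)) (Icc 0 T) t)
    (h0 : Tendsto (fun N => xN N 0) atTop (𝓝 (y 0))) :
    ∃ b : ℕ → ℝ, Tendsto b atTop (𝓝 0) ∧ ∀ᶠ N in atTop, ∀ t ∈ Icc 0 T, ‖xN N t - y t‖ ≤ b N := by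
  have hyc : ContinuousOn y (Icc 0 T) := fun s hs => (hy s hs).continuousWithinAt
  obtain ⟨Y, hY⟩ := isCompact_Icc.exists_bound_of_continuousOn hyc
  obtain ⟨R, hR⟩ := isCompact_Icc.exists_bound_of_continuousOn hL
  have hK0 : 0 ≤ K := by
    obtain ⟨N, hN⟩ := hK.exists
    exact (norm_nonneg _).trans (hN 0 ⟨le_rfl, hT⟩)
  refine exists_tendsto_zero_of_norm_deriv_le (f := fun N t => xN N t - y t)
    (f' := fun N t => LN N t (xN N t) - L t (y t))
    (ε := fun N t => ‖(LN N t - L t) (y t)‖) (M := (K + R) * Y) hT hK0 ?_ ?_ ?_ ?_ ?_ ?_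
  · filter_upwards [hxN] with N hN t ht
    exact (hN t ht).sub (hy t ht)
  · filter_upwards [hLN] with N hN
    fun_prop
  · filter_upwards [hK] with N hN t ht
    refine ⟨norm_nonneg _, (ContinuousLinearMap.le_opNorm _ _).trans ?_⟩
    have h1 : ‖LN N t - L t‖ ≤ K + R := (norm_sub_le _ _).trans (add_le_add (hN t ht) (hR t ht))
    exact mul_le_mul h1 (hY t ht) (norm_nonneg _) ((norm_nonneg _).trans h1)
  · intro t ht
    simpa using ((hlim t ht (y t)).sub_const (L t (y t))).norm
  · simpa using h0.sub_const (y 0)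
  · filter_upwards [hK] with N hN t ht
    -- With this splitting the coefficient error acts on the fixed limit curve, so strong
    -- convergence of the coefficients suffices.
    have e : LN N t (xN N t) - L t (y t) = LN N t (xN N t - y t) + (LN N t - L t) (y t) := by
      simp only [map_sub, sub_apply]
      abel
    rw [e]
    refine (norm_add_le _ _).trans (add_le_add (((LN N t).le_opNorm _).trans ?_) le_rfl)
    gcongr
    exact hN t ht

variable [CompleteSpace H]

/-- Mild solutions with continuous inhomogeneity are classical solutions. -/
theorem hasDerivWithinAt_of_mild {A : H →L[ℝ] H} {w x : ℝ → H} {T : ℝ} (hT : 0 ≤ T)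
    (hw : ContinuousOn w (Icc 0 T))
    (hx : ∀ t ∈ Icc 0 T, x t = NormedSpace.exp (t • A) (x 0)
      + ∫ s in (0 : ℝ)..t, NormedSpace.exp ((t - s) • A) (w s)) :
    ∀ t ∈ Icc 0 T, HasDerivWithinAt x (A (x t) + w t) (Icc 0 T) t := by
  set w' : ℝ → H := IccExtend hT ((Icc 0 T).domRestrict w) with hw'
  have hwc : Continuous w' := hw.domRestrict.Icc_extend'
  have hww : ∀ s ∈ Icc 0 T, w' s = w s := fun s hs => IccExtend_of_mem hT _ hs
  let _ : NormedAlgebra ℚ (H →L[ℝ] H) := NormedAlgebra.restrictScalars ℚ ℝ _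
  have hexp : Continuous fun s : ℝ => NormedSpace.exp ((-s) • A) :=
    (NormedSpace.exp_continuous (𝔸 := H →L[ℝ] H)).comp (by fun_prop)
  have hi : Continuous fun s => NormedSpace.exp ((-s) • A) (w' s) := hexp.clm_apply hwc
  -- Factoring `exp ((t - s) A)` as `exp (t A) exp (-s A)` moves `t` out of the integrand, so that
  -- the product rule applies.
  set g : ℝ → H := fun t => NormedSpace.exp (t • A)
    (x 0 + ∫ s in (0 : ℝ)..t, NormedSpace.exp ((-s) • A) (w' s)) with hg
  have hadd : ∀ t s : ℝ, NormedSpace.exp ((t - s) • A)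
      = NormedSpace.exp (t • A) * NormedSpace.exp ((-s) • A) := fun t s => by
    rw [← NormedSpace.exp_add_of_commute
      (((Commute.refl A).smul_left t).smul_right (-s)), ← add_smul, sub_eq_add_neg]
  have hxg : ∀ t ∈ Icc 0 T, x t = g t := by
    intro t ht
    rw [hx t ht, hg]
    simp only [map_add]
    rw [← ContinuousLinearMap.intervalIntegral_comp_comm _ (hi.intervalIntegrable 0 t)]
    congr 1
    refine intervalIntegral.integral_congr fun s hs => ?_
    rw [uIcc_of_le ht.1] at hs
    simp only [hadd t s, hww s ⟨hs.1, hs.2.trans ht.2⟩]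
    rfl
  have hgd : ∀ t, HasDerivAt g (A (g t) + w' t) t := by
    intro t
    have h1 := hasDerivAt_exp_smul_const' (𝕂 := ℝ) A t
    have h2 := (hi.integral_hasStrictDerivAt 0 t).hasDerivAt.const_add (x 0)
    refine (h1.clm_apply h2).congr_deriv ?_
    have h3 : NormedSpace.exp (t • A) (NormedSpace.exp ((-t) • A) (w' t)) = w' t := by
      change (NormedSpace.exp (t • A) * NormedSpace.exp ((-t) • A)) (w' t) = w' t
      rw [← hadd t t, sub_self, zero_smul, NormedSpace.exp_zero]
      rfl
    rw [h3]
    rfl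
  intro t ht
  rw [hxg t ht, ← hww t ht]
  exact (hgd t).hasDerivWithinAt.congr hxg (hxg t ht)

/-- The trajectory of a closed loop solves a linear differential equation. -/
theorem IsClosedLoop.hasDerivWithinAt {T : ℝ} (hT : 0 ≤ T) {A B : L2 →L[ℝ] L2}
    {P : ℝ → L2 →L[ℝ] L2} {x₀ : L2} {u x : ℝ → L2} (h : IsClosedLoop T A B P x₀ u x)
    (hP : ContinuousOn P (Icc 0 T)) :
    ∀ t ∈ Icc 0 T, HasDerivWithinAt x ((A - B ∘L (B†) ∘L P (T - t)) (x t)) (Icc 0 T) t := by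
  have hmaps : MapsTo (fun t => T - t) (Icc 0 T) (Icc 0 T) := fun t ht =>
    ⟨by linarith [ht.2], by linarith [ht.1]⟩
  have hPT : ContinuousOn (fun t => P (T - t)) (Icc 0 T) := hP.comp (by fun_prop) hmaps
  have hx := h.solution.continuousOn
  -- The control is only given as square integrable, but the feedback law makes it continuous.
  have hw : ContinuousOn (fun t => B (u t)) (Icc 0 T) := by
    refine ContinuousOn.congr (f := fun t => B (-((B†) (P (T - t) (x t)))))
      (B.continuous.comp_continuousOn ((B†).continuous.comp_continuousOn (hPT.clm_apply hx)).neg) ?_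
    intro t ht
    simp only [h.feedback t ht]
  intro t ht
  refine (hasDerivWithinAt_of_mild (A := A) (w := fun t => B (u t)) hT hw (fun t ht => ?_)
    t ht).congr_deriv ?_
  · simpa using h.solution.mild 0 t le_rfl ht.1 ht.2
  · simp [h.feedback t ht, sub_eq_add_neg]

/-- Convergence of closed loops, and of their costs, to those of a limit system. -/
theorem closedLoop_tendsto {T M : ℝ} (hT : 0 ≤ T) {AN BN CN P₀N : ℕ → L2 →L[ℝ] L2}
    {A B C P₀ : L2 →L[ℝ] L2} {PN : ℕ → ℝ → L2 →L[ℝ] L2} {P : ℝ → L2 →L[ℝ] L2}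
    {uN xN : ℕ → ℝ → L2} {x₀N : ℕ → L2} {y : ℝ → L2}
    (hA : Tendsto AN atTop (𝓝 A)) (hB : Tendsto BN atTop (𝓝 B))
    (hC : ∀ v, Tendsto (fun N => CN N v) atTop (𝓝 (C v)))
    (hP₀ : ∀ v, Tendsto (fun N => P₀N N v) atTop (𝓝 (P₀ v)))
    (hPNc : ∀ᶠ N in atTop, ContinuousOn (PN N) (Icc 0 T)) (hPc : ContinuousOn P (Icc 0 T))
    (hM : ∀ᶠ N in atTop, ∀ t ∈ Icc 0 T, ‖PN N t‖ ≤ M)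
    (hlim : ∀ t ∈ Icc 0 T, ∀ v, Tendsto (fun N => PN N t v) atTop (𝓝 (P t v)))
    (hloop : ∀ᶠ N in atTop, IsClosedLoop T (AN N) (BN N) (PN N) (x₀N N) (uN N) (xN N))
    (hy : ∀ t ∈ Icc 0 T,
      HasDerivWithinAt y ((A - B ∘L (B†) ∘L P (T - t)) (y t)) (Icc 0 T) t)
    (h0 : Tendsto x₀N atTop (𝓝 (y 0))) :
    (∀ t ∈ Icc 0 T, Tendsto (fun N => xN N t) atTop (𝓝 (y t))) ∧
      Tendsto (fun N => cost T (CN N) (P₀N N) (uN N) (xN N)) atTop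
        (𝓝 (cost T C P₀ (fun t => -((B†) (P (T - t) (y t)))) y)) := by
  have hM0 : 0 ≤ M := by
    obtain ⟨N, hN⟩ := hM.exists
    exact (norm_nonneg _).trans (hN 0 ⟨le_rfl, hT⟩)
  have hmaps : MapsTo (fun t => T - t) (Icc 0 T) (Icc 0 T) := fun t ht =>
    ⟨by linarith [ht.2], by linarith [ht.1]⟩
  have hPT : ContinuousOn (fun t => P (T - t)) (Icc 0 T) := hPc.comp (by fun_prop) hmaps
  have hPNT : ∀ᶠ N in atTop, ContinuousOn (fun t => PN N (T - t)) (Icc 0 T) := by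
    filter_upwards [hPNc] with N hN using hN.comp (by fun_prop) hmaps
  have hB' : Tendsto (fun N => ((BN N)†)) atTop (𝓝 (B†)) :=
    ((ContinuousLinearMap.adjoint (𝕜 := ℝ) (E := L2) (F := L2)).continuous.tendsto B).comp hB
  obtain ⟨a, ha⟩ := hA.norm.bddAbove_range
  obtain ⟨β, hβ⟩ := hB.norm.bddAbove_range
  have hβN : ∀ N, ‖BN N‖ ≤ β := fun N => hβ ⟨N, rfl⟩
  have hβN' : ∀ N, ‖((BN N)†)‖ ≤ β := fun N => by
    rw [LinearIsometryEquiv.norm_map]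
    exact hβN N
  have hβ0 : 0 ≤ β := (norm_nonneg _).trans (hβN 0)
  have hcomp : ∀ X Z : L2 →L[ℝ] L2, ‖X ∘L Z‖ ≤ ‖X‖ * ‖Z‖ := ContinuousLinearMap.opNorm_comp_le
  have happly : ∀ {XN : ℕ → L2 →L[ℝ] L2} {X : L2 →L[ℝ] L2} {v : ℕ → L2} {w : L2},
      Tendsto XN atTop (𝓝 X) → Tendsto v atTop (𝓝 w) →
      Tendsto (fun N => XN N (v N)) atTop (𝓝 (X w)) := fun hX hv =>
    ((continuous_fst.clm_apply continuous_snd).tendsto (_, _)).comp (hX.prodMk_nhds hv)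
  have hloop0 : Tendsto (fun N => xN N 0) atTop (𝓝 (y 0)) :=
    h0.congr' (by filter_upwards [hloop] with N hN using hN.solution.initial.symm)
  -- The constant `a + β * (β * M)` bounds the closed-loop generators uniformly in `N` and `t`.
  obtain ⟨b, hb, hbound⟩ := linear_ode_tendsto hT
    (LN := fun N t => AN N - BN N ∘L ((BN N)†) ∘L PN N (T - t)) (xN := xN)
    (L := fun t => A - B ∘L (B†) ∘L P (T - t)) (y := y) (K := a + β * (β * M))
    (by
      filter_upwards [hPNT] with N hN
      exact continuousOn_const.sub (continuousOn_const.clm_comp (continuousOn_const.clm_comp hN)))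
    (continuousOn_const.sub (continuousOn_const.clm_comp (continuousOn_const.clm_comp hPT)))
    (by
      filter_upwards [hM] with N hN t ht
      have h1 := hN _ (hmaps ht)
      have h2 := hβN N
      have h3 := hβN' N
      refine (norm_sub_le _ _).trans (add_le_add (ha ⟨N, rfl⟩) ((hcomp _ _).trans ?_))
      gcongr
      exact (hcomp _ _).trans (by gcongr))
    (fun t ht v => by
      have h1 : Tendsto (fun N => AN N v) atTop (𝓝 (A v)) := happly hA tendsto_const_nhds
      have h2 := happly hB (happly hB' (hlim _ (hmaps ht) v))
      exact h1.sub h2)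
    (by
      filter_upwards [hloop, hPNc] with N h1 h2
      exact h1.hasDerivWithinAt hT h2)
    hy hloop0
  have hx : ∀ t ∈ Icc 0 T, Tendsto (fun N => xN N t) atTop (𝓝 (y t)) := by
    intro t ht
    rw [tendsto_iff_norm_sub_tendsto_zero]
    refine squeeze_zero_norm' ?_ hb
    filter_upwards [hbound] with N hN
    simpa using hN t ht
  refine ⟨hx, ?_⟩
  have hyc : ContinuousOn y (Icc 0 T) := fun s hs => (hy s hs).continuousWithinAt
  obtain ⟨Y, hY⟩ := isCompact_Icc.exists_bound_of_continuousOn hyc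
  have hxb : ∀ᶠ N in atTop, ∀ t ∈ Icc 0 T, ‖xN N t‖ ≤ 1 + Y := by
    filter_upwards [hbound, hb.eventually (ge_mem_nhds zero_lt_one)] with N h1 h2 t ht
    calc ‖xN N t‖ = ‖xN N t - y t + y t‖ := by rw [sub_add_cancel]
      _ ≤ 1 + Y := (norm_add_le _ _).trans (add_le_add ((h1 t ht).trans h2) (hY t ht))
  have hY0 : 0 ≤ 1 + Y := by
    obtain ⟨N, hN⟩ := hxb.exists
    exact (norm_nonneg _).trans (hN 0 ⟨le_rfl, hT⟩)
  obtain ⟨c, hc⟩ := exists_norm_le_of_tendsto hC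
  obtain ⟨p, hp⟩ := exists_norm_le_of_tendsto hP₀
  have hc0 : 0 ≤ c := (norm_nonneg _).trans (hc 0)
  have hsub : ∀ {s}, s ∈ uIoc 0 T → s ∈ Icc 0 T := fun hs => by
    rw [uIoc_of_le hT] at hs
    exact ⟨hs.1.le, hs.2⟩
  have hu : ∀ t ∈ Icc 0 T, Tendsto (fun N => uN N t) atTop (𝓝 (-((B†) (P (T - t) (y t))))) := by
    intro t ht
    have h1 := tendsto_apply_of_strong (hlim _ (hmaps ht))
      (by filter_upwards [hM] with N hN using hN _ (hmaps ht)) (hx t ht)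
    refine (happly hB' h1).neg.congr' ?_
    filter_upwards [hloop] with N hN using (hN.feedback t ht).symm
  have hub : ∀ᶠ N in atTop, ∀ t ∈ Icc 0 T, ‖uN N t‖ ≤ β * (M * (1 + Y)) := by
    filter_upwards [hloop, hM, hxb] with N h1 h2 h3 t ht
    rw [h1.feedback t ht, norm_neg]
    have h4 := hβN' N
    have h5 := h2 _ (hmaps ht)
    have h6 := h3 t ht
    refine (ContinuousLinearMap.le_opNorm _ _).trans ?_
    gcongr
    exact (ContinuousLinearMap.le_opNorm _ _).trans (by gcongr)
  have huc : ∀ᶠ N in atTop, ContinuousOn (uN N) (Icc 0 T) := by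
    filter_upwards [hloop, hPNT] with N h1 h2
    have h3 := h1.solution.continuousOn
    exact ContinuousOn.congr (f := fun t => -(((BN N)†) (PN N (T - t) (xN N t))))
      (((BN N)†).continuous.comp_continuousOn (h2.clm_apply h3)).neg h1.feedback
  unfold cost
  refine Tendsto.add ?_ ?_
  -- States and controls converge pointwise in time and are eventually uniformly bounded, so the
  -- running costs converge by dominated convergence.
  · refine intervalIntegral.tendsto_integral_filter_of_dominated_convergence
      (fun _ => (c * (1 + Y)) ^ 2 + (β * (M * (1 + Y))) ^ 2) ?_ ?_ intervalIntegrable_const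
      (ae_of_all _ fun t ht => ?_)
    · filter_upwards [hloop, huc] with N h1 h2
      have h3 := h1.solution.continuousOn
      have h4 : ContinuousOn (fun t => ‖CN N (xN N t)‖ ^ 2 + ‖uN N t‖ ^ 2) (Icc 0 T) := by
        fun_prop
      exact (h4.mono fun s hs => hsub hs).aestronglyMeasurable measurableSet_uIoc
    · filter_upwards [hxb, hub] with N h1 h2
      refine ae_of_all _ fun t ht => ?_
      rw [Real.norm_of_nonneg (by positivity)]
      have h3 := h1 t (hsub ht)
      have h4 := h2 t (hsub ht)
      have h5 : ‖CN N (xN N t)‖ ≤ c * (1 + Y) := by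
        have := hc N
        exact (ContinuousLinearMap.le_opNorm _ _).trans (by gcongr)
      gcongr
    · exact ((tendsto_apply_of_strong hC (Eventually.of_forall hc)
        (hx t (hsub ht))).norm.pow 2).add ((hu t (hsub ht)).norm.pow 2)
  · have hTm := hx T ⟨hT, le_rfl⟩
    exact (tendsto_apply_of_strong hP₀ (Eventually.of_forall hp) hTm).inner hTm

end ClosedLoop

/-! ### Step function approximation as compression by the averaging projection. -/

section StepApprox

theorem cell_eq_of_mem {K : ℕ} {i j : Fin K} {x : I} (hi : x ∈ cell K i) (hj : x ∈ cell K j) :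
    i = j := by
  have key : ∀ i j : Fin K, x ∈ cell K i → x ∈ cell K j → j ≤ i := by
    intro i j hi hj
    by_contra! h
    have hlt : (i : ℕ) + 1 ≤ j := h
    have hjK := j.2
    rcases hi.2 with h1 | h1
    · have h2 : ((i : ℝ) + 1) / K ≤ (j : ℝ) / K := by
        gcongr
        exact_mod_cast hlt
      exact absurd (h1.trans_le (h2.trans hj.1)) (lt_irrefl _)
    · omega
  exact le_antisymm (key j i hj hi) (key i j hi hj)

theorem exists_mem_cell {K : ℕ} (hK : 0 < K) (x : I) : ∃ i, x ∈ cell K i := by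
  have hK' : (0 : ℝ) < K := by exact_mod_cast hK
  have hxK : 0 ≤ (x : ℝ) * K := mul_nonneg x.2.1 hK'.le
  rcases lt_or_ge ⌊(x : ℝ) * K⌋₊ K with h | h
  · refine ⟨⟨⌊(x : ℝ) * K⌋₊, h⟩, ?_, Or.inl ?_⟩
    · rw [div_le_iff₀ hK']
      exact Nat.floor_le hxK
    · rw [lt_div_iff₀ hK']
      exact Nat.lt_floor_add_one _
  -- This case is the endpoint `x = 1`, which belongs to the closed last cell.
  · refine ⟨⟨K - 1, by omega⟩, ?_, Or.inr (by simp only; omega)⟩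
    rw [div_le_iff₀ hK']
    have h1 : (K : ℝ) ≤ (x : ℝ) * K := (Nat.cast_le.2 h).trans (Nat.floor_le hxK)
    refine le_trans ?_ h1
    exact_mod_cast Nat.sub_le K 1

theorem abs_sub_le_of_mem_cell {K : ℕ} {i : Fin K} {x : I} (hx : x ∈ cell K i) :
    |(x : ℝ) - (i : ℝ) / K| ≤ 1 / K := by
  have hK' : (0 : ℝ) < K := by exact_mod_cast i.pos
  rw [abs_of_nonneg (sub_nonneg.2 hx.1), sub_le_iff_le_add, ← add_div]
  rcases hx.2 with h | h
  · rw [add_comm]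
    exact h.le
  · have h1 : (1 : ℝ) + i = K := by
      rw [add_comm]
      exact_mod_cast h
    rw [h1, div_self hK'.ne']
    exact x.2.2

theorem sum_indicator_of_mem_cell {K : ℕ} {i : Fin K} {x : I} (hx : x ∈ cell K i)
    (c : Fin K → ℝ) : ∑ j, c j * (cell K j).indicator (1 : I → ℝ) x = c i := by
  rw [Finset.sum_eq_single i]
  · simp [hx]
  · intro j _ hj
    rw [indicator_of_notMem (fun h => hj (cell_eq_of_mem h hx)), mul_zero]
  · simp

theorem coeFn_cellL2 (K : ℕ) (i : Fin K) :
    cellL2 K i =ᵐ[volume] (cell K i).indicator (1 : I → ℝ) :=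
  indicatorConstLp_coeFn

theorem coeFn_sum_cellL2 {K : ℕ} (c : Fin K → ℝ) :
    (∑ i, c i • cellL2 K i : L2) =ᵐ[volume]
      fun x => ∑ i, c i * (cell K i).indicator (1 : I → ℝ) x := by
  have h1 : ∀ᵐ x ∂(volume : Measure I), ∀ i, (c i • cellL2 K i : L2) x
      = c i * (cell K i).indicator (1 : I → ℝ) x := by
    rw [ae_all_iff]
    intro i
    filter_upwards [Lp.coeFn_smul (c i) (cellL2 K i), coeFn_cellL2 K i] with x hx hx'
    rw [hx, Pi.smul_apply, hx', smul_eq_mul]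
  filter_upwards [Lp.coeFn_finsetSum Finset.univ fun i => c i • cellL2 K i, h1] with x hx hx'
  rw [hx, Finset.sum_apply]
  exact Finset.sum_congr rfl fun i _ => hx' i

theorem inner_cellL2 (K : ℕ) (i : Fin K) (v : L2) : ⟪cellL2 K i, v⟫_ℝ = ∫ x in cell K i, v x :=
  L2.inner_indicatorConstLp_one (measurableSet_cell K i) (measure_ne_top volume _) v

theorem inner_cellL2_self (K : ℕ) (i : Fin K) :
    ⟪cellL2 K i, cellL2 K i⟫_ℝ = (volume : Measure I).real (cell K i) := by
  rw [inner_cellL2, integral_congr_ae (ae_restrict_of_ae (coeFn_cellL2 K i)),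
    setIntegral_indicator (measurableSet_cell K i)]
  simp

theorem inner_cellL2_of_ne {K : ℕ} {i j : Fin K} (hij : i ≠ j) :
    ⟪cellL2 K i, cellL2 K j⟫_ℝ = 0 := by
  rw [inner_cellL2, integral_congr_ae (ae_restrict_of_ae (coeFn_cellL2 K j)),
    setIntegral_indicator (measurableSet_cell K j)]
  have : cell K i ∩ cell K j = ∅ := by
    ext x
    simp only [mem_inter_iff, mem_empty_iff_false, iff_false, not_and]
    exact fun hi hj => hij (cell_eq_of_mem hi hj)
  simp [this]

/-- The averaging operator over the cells of the uniform partition, that is, the orthogonal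
projection onto the step functions. -/
def cellAverage (K : ℕ) : L2 →L[ℝ] L2 :=
  ∑ i : Fin K, ((volume : Measure I).real (cell K i))⁻¹ •
    (innerSL ℝ (cellL2 K i)).smulRight (cellL2 K i)

theorem cellAverage_apply (K : ℕ) (v : L2) : cellAverage K v =
    ∑ i : Fin K, (((volume : Measure I).real (cell K i))⁻¹ * ⟪cellL2 K i, v⟫_ℝ) • cellL2 K i := by
  simp [cellAverage, smul_smul]

theorem cellAverage_cellL2 (K : ℕ) (i : Fin K) : cellAverage K (cellL2 K i) = cellL2 K i := by
  rw [cellAverage_apply, Finset.sum_eq_single i]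
  · rw [inner_cellL2_self]
    -- The measure of a cell is never computed: if it were zero, the indicator would be the zero
    -- vector of `L²`.
    rcases eq_or_ne ((volume : Measure I).real (cell K i)) 0 with h | h
    · have : cellL2 K i = 0 := by rw [← inner_self_eq_zero (𝕜 := ℝ), inner_cellL2_self, h]
      rw [this, smul_zero]
    · rw [inv_mul_cancel₀ h, one_smul]
  · intro j _ hj
    rw [inner_cellL2_of_ne hj, mul_zero, zero_smul]
  · simp

theorem cellAverage_sum {K : ℕ} (c : Fin K → ℝ) :
    cellAverage K (∑ i, c i • cellL2 K i) = ∑ i, c i • cellL2 K i := by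
  simp [map_sum, cellAverage_cellL2]

theorem inner_cellAverage_left (K : ℕ) (v w : L2) :
    ⟪cellAverage K v, w⟫_ℝ = ⟪v, cellAverage K w⟫_ℝ := by
  simp only [cellAverage_apply, sum_inner, inner_sum, inner_smul_left, inner_smul_right]
  refine Finset.sum_congr rfl fun i _ => ?_
  rw [real_inner_comm v]
  simp only [conj_trivial]
  ring

/-- A symmetric idempotent `E` satisfies `‖E v‖² = ⟪E v, v⟫`, and Cauchy–Schwarz finishes. -/
theorem norm_cellAverage_le (K : ℕ) : ‖cellAverage K‖ ≤ 1 := by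
  refine ContinuousLinearMap.opNorm_le_bound _ zero_le_one fun v => ?_
  have h1 : ‖cellAverage K v‖ * ‖cellAverage K v‖ ≤ ‖cellAverage K v‖ * ‖v‖ := by
    rw [← real_inner_self_eq_norm_mul_norm, ← inner_cellAverage_left, cellAverage_apply K v,
      cellAverage_sum]
    exact real_inner_le_norm _ _
  rw [one_mul]
  rcases (norm_nonneg (cellAverage K v)).eq_or_lt with h | h
  · rw [← h]
    exact norm_nonneg v
  · exact le_of_mul_le_mul_left h1 h

theorem norm_L2_le_of_ae_bound {v : L2} {c : ℝ} (hc : 0 ≤ c) (h : ∀ᵐ x, ‖v x‖ ≤ c) :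
    ‖v‖ ≤ c := by
  have hm : measureUnivNNReal (volume : Measure I) = 1 := by simp [measureUnivNNReal]
  simpa [hm] using Lp.norm_le_of_ae_bound hc h

/-- Continuous functions are dense and, by uniform continuity, close to step functions on fine
partitions. Averaging is a contraction that fixes step functions, so it moves `v` by at most twice
the distance from `v` to a step function. -/
theorem cellAverage_tendsto (v : L2) : Tendsto (fun K => cellAverage K v) atTop (𝓝 v) := by
  rw [Metric.tendsto_atTop]
  intro ε hε
  obtain ⟨f, hf⟩ := (ContinuousMap.toLp_denseRange (E := ℝ) (p := 2) (volume : Measure I) ℝ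
    (by norm_num)).exists_dist_lt v (show 0 < ε / 4 by positivity)
  obtain ⟨δ, hδ, hδf⟩ := Metric.uniformContinuous_iff.1
    (CompactSpace.uniformContinuous_of_continuous f.continuous) (ε / 4) (by positivity)
  obtain ⟨K₀, hK₀⟩ := exists_nat_one_div_lt hδ
  refine ⟨K₀ + 1, fun K hK => ?_⟩
  have hKpos : 0 < K := by omega
  have hK' : (0 : ℝ) < K := by exact_mod_cast hKpos
  have hKδ : 1 / (K : ℝ) < δ := by
    refine lt_of_le_of_lt ?_ hK₀
    gcongr
    exact_mod_cast hK
  have hmem : ∀ i : Fin K, (i : ℝ) / K ∈ I := fun i =>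
    ⟨by positivity, (div_le_one hK').2 (by exact_mod_cast i.2.le)⟩
  -- The continuous approximant sampled at the left endpoints of the cells.
  set s : L2 := ∑ i : Fin K, f ⟨(i : ℝ) / K, hmem i⟩ • cellL2 K i with hs
  set F : L2 := ContinuousMap.toLp 2 volume ℝ f with hF
  have hFs : ‖F - s‖ ≤ ε / 4 := by
    refine norm_L2_le_of_ae_bound (by positivity) ?_
    filter_upwards [Lp.coeFn_sub F s, ContinuousMap.coeFn_toLp (E := ℝ) (p := 2) (𝕜 := ℝ)
      (volume : Measure I) f, coeFn_sum_cellL2 (K := K) fun i => f ⟨(i : ℝ) / K, hmem i⟩]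
      with x h1 h2 h3
    obtain ⟨i, hi⟩ := exists_mem_cell hKpos x
    rw [h1, Pi.sub_apply, hF, h2, hs, h3,
      sum_indicator_of_mem_cell hi fun i => f ⟨(i : ℝ) / K, hmem i⟩, ← dist_eq_norm]
    refine (hδf ?_).le
    rw [Subtype.dist_eq, Real.dist_eq]
    exact (abs_sub_le_of_mem_cell hi).trans_lt hKδ
  have hvs : ‖v - s‖ < ε / 2 := by
    calc ‖v - s‖ = ‖(v - F) + (F - s)‖ := by rw [sub_add_sub_cancel]
      _ ≤ ‖v - F‖ + ‖F - s‖ := norm_add_le _ _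
      _ < ε / 4 + ε / 4 := add_lt_add_of_lt_of_le (by rwa [← dist_eq_norm]) hFs
      _ = ε / 2 := by ring
  have hEs : cellAverage K s = s := cellAverage_sum _
  have e : cellAverage K v - v = cellAverage K (v - s) - (v - s) := by
    rw [map_sub, hEs]
    abel
  rw [dist_eq_norm, e]
  calc ‖cellAverage K (v - s) - (v - s)‖ ≤ ‖cellAverage K (v - s)‖ + ‖v - s‖ := norm_sub_le _ _
    _ ≤ 1 * ‖v - s‖ + ‖v - s‖ := by
        gcongr
        exact (cellAverage K).le_of_opNorm_le (norm_cellAverage_le K) _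
    _ < ε := by linarith

theorem stepKernel_op_apply {K : ℕ} (M : Matrix (Fin K) (Fin K) ℝ) (v : L2) :
    (stepKernel M).op v = ∑ i, (∑ j, M i j * ⟪cellL2 K j, v⟫_ℝ) • cellL2 K i := by
  refine Lp.ext ?_
  filter_upwards [(stepKernel M).coeFn_op v,
    coeFn_sum_cellL2 fun i => ∑ j, M i j * ⟪cellL2 K j, v⟫_ℝ] with x h1 h2
  rw [h1, h2]
  have hv : Integrable v (volume : Measure I) := (Lp.memLp v).integrable (by norm_num)
  have hi : ∀ j : Fin K, Integrable (fun y => (cell K j).indicator 1 y * v y) volume := by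
    intro j
    refine (hv.indicator (measurableSet_cell K j)).congr (ae_of_all _ fun y => ?_)
    by_cases hy : y ∈ cell K j <;> simp [hy]
  have hint : ∀ j : Fin K, ∫ y, (cell K j).indicator 1 y * v y = ⟪cellL2 K j, v⟫_ℝ := by
    intro j
    rw [inner_cellL2, ← integral_indicator (measurableSet_cell K j)]
    refine integral_congr_ae (ae_of_all _ fun y => ?_)
    by_cases hy : y ∈ cell K j <;> simp [hy]
  have hexp : ∀ y, (stepKernel M).toFun x y * v y = ∑ i, ∑ j,
      ((cell K i).indicator 1 x * M i j) * ((cell K j).indicator 1 y * v y) := by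
    intro y
    simp only [stepKernel, Finset.sum_mul]
    exact Finset.sum_congr rfl fun i _ => Finset.sum_congr rfl fun j _ => by ring
  simp only [hexp]
  rw [integral_finsetSum _ fun i _ => integrable_finsetSum _ fun j _ => (hi j).const_mul _]
  refine Finset.sum_congr rfl fun i _ => ?_
  rw [integral_finsetSum _ fun j _ => (hi j).const_mul _, Finset.sum_mul]
  refine Finset.sum_congr rfl fun j _ => ?_
  rw [integral_const_mul, hint]
  ring

/-- The step function approximation is the compression to the step functions. -/
theorem stepApprox_eq (K : ℕ) (P : L2 →L[ℝ] L2) :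
    stepApprox K P = cellAverage K ∘L P ∘L cellAverage K := by
  ext1 v
  rw [stepApprox, stepKernel_op_apply, ContinuousLinearMap.comp_apply,
    ContinuousLinearMap.comp_apply, cellAverage_apply K (P _)]
  refine Finset.sum_congr rfl fun i _ => ?_
  congr 1
  rw [cellAverage_apply, map_sum, inner_sum, Finset.mul_sum]
  refine Finset.sum_congr rfl fun j _ => ?_
  rw [map_smul, inner_smul_right, Matrix.of_apply, div_eq_mul_inv, mul_inv]
  ring

theorem norm_stepApprox_le (K : ℕ) (P : L2 →L[ℝ] L2) : ‖stepApprox K P‖ ≤ ‖P‖ := by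
  have h := norm_cellAverage_le K
  rw [stepApprox_eq]
  calc ‖cellAverage K ∘L P ∘L cellAverage K‖ ≤ ‖cellAverage K‖ * (‖P‖ * ‖cellAverage K‖) :=
        (ContinuousLinearMap.opNorm_comp_le _ _).trans
          (mul_le_mul_of_nonneg_left (ContinuousLinearMap.opNorm_comp_le _ _) (norm_nonneg _))
    _ ≤ 1 * (‖P‖ * 1) := by gcongr
    _ = ‖P‖ := by ring

theorem stepApprox_tendsto (P : L2 →L[ℝ] L2) (v : L2) :
    Tendsto (fun K => stepApprox K P v) atTop (𝓝 (P v)) := by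
  have h1 : Tendsto (fun K => P (cellAverage K v)) atTop (𝓝 (P v)) :=
    (P.continuous.tendsto v).comp (cellAverage_tendsto v)
  rw [tendsto_iff_norm_sub_tendsto_zero]
  have h2 := (tendsto_iff_norm_sub_tendsto_zero.1 h1).add
    (tendsto_iff_norm_sub_tendsto_zero.1 (cellAverage_tendsto (P v)))
  rw [add_zero] at h2
  refine squeeze_zero (fun _ => norm_nonneg _) (fun K => ?_) h2
  have e : stepApprox K P v - P v
      = cellAverage K (P (cellAverage K v) - P v) + (cellAverage K (P v) - P v) := by
    rw [stepApprox_eq, map_sub]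
    simp only [ContinuousLinearMap.comp_apply]
    abel
  rw [e]
  refine (norm_add_le _ _).trans (add_le_add ?_ le_rfl)
  simpa using (cellAverage K).le_of_opNorm_le (norm_cellAverage_le K) (P (cellAverage K v) - P v)

theorem continuousOn_stepApprox (K : ℕ) {P : ℝ → L2 →L[ℝ] L2} {s : Set ℝ}
    (hP : ContinuousOn P s) : ContinuousOn (fun t => stepApprox K (P t)) s := by
  simp only [stepApprox_eq]
  exact continuousOn_const.clm_comp (hP.clm_comp continuousOn_const)

end StepApprox

/-! ### Convergence of the system and cost operators. -/

theorem SysOpConverges.tendsto_sysOp {a : ℕ → ℝ} {W : ℕ → BddKernel} {a' : ℝ} {W' : BddKernel}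
    (h : SysOpConverges a W a' W') :
    Tendsto (fun N => sysOp (a N) (W N)) atTop (𝓝 (sysOp a' W')) := by
  refine (h.1.smul_const _).add ?_
  rw [tendsto_iff_norm_sub_tendsto_zero]
  simpa only [norm_sub_rev] using h.2.2

/-- Taking adjoints is not strongly continuous in general. Self-adjointness turns the expression
into a square, and products of bounded strongly convergent sequences converge strongly. -/
theorem tendsto_adjoint_apply_of_isSelfAdjoint {CN : ℕ → L2 →L[ℝ] L2} {C : L2 →L[ℝ] L2}
    (hCN : ∀ N, 1 ≤ N → IsSelfAdjoint (CN N)) (hC : IsSelfAdjoint C)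
    (hconv : ∀ v, Tendsto (fun N => CN N v) atTop (𝓝 (C v))) (v : L2) :
    Tendsto (fun N => ((CN N)†) (CN N v)) atTop (𝓝 ((C†) (C v))) := by
  obtain ⟨c, hc⟩ := exists_norm_le_of_tendsto hconv
  rw [hC.adjoint_eq]
  refine (tendsto_apply_of_strong hconv (Eventually.of_forall hc) (hconv v)).congr' ?_
  filter_upwards [eventually_ge_atTop 1] with N hN
  rw [(hCN N hN).adjoint_eq]

end GraphonLQR

end

/-! ### Comparison of both feedback loops with the common limit loop. -/

theorem mainTheorem2
    -- the time horizon `[0,T]` and the dimension `n` of the state space of a node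
    (T : ℝ) (hT : 0 < T) (n : ℕ) (hn : 1 ≤ n)
    -- the network systems `(α_N I + A_N; β_N I + B_N)`, `N ≥ 1`
    (αN βN : ℕ → ℝ)
    (AN BN : (N : ℕ) → Matrix (Fin (n * N)) (Fin (n * N)) ℝ)
    (hAN : ∀ N, 1 ≤ N → GraphonLQR.IsNetworkMatrix (AN N))
    (hBN : ∀ N, 1 ≤ N → GraphonLQR.IsNetworkMatrix (BN N))
    -- they converge to the graphon system `(α I + A; β I + B)`
    (α β : ℝ) (A B : GraphonLQR.BddKernel)
    (hA : GraphonLQR.SysOpConverges αN (fun N => GraphonLQR.stepKernel (AN N)) α A)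
    (hB : GraphonLQR.SysOpConverges βN (fun N => GraphonLQR.stepKernel (BN N)) β B)
    -- the operators in the costs
    (CN P₀N : ℕ → GraphonLQR.L2 →L[ℝ] GraphonLQR.L2) (C P₀ : GraphonLQR.L2 →L[ℝ] GraphonLQR.L2)
    (hP₀N : ∀ N, 1 ≤ N → (P₀N N).IsPositive)
    (hCN : ∀ N, 1 ≤ N → IsSelfAdjoint (CN N)) (hC : IsSelfAdjoint C)
    (hCconv : ∀ v, Tendsto (fun N => CN N v) atTop (𝓝 (C v)))
    (hP₀conv : ∀ v, Tendsto (fun N => P₀N N v) atTop (𝓝 (P₀ v)))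
    -- the solutions of the Riccati equations of the limit system and of the network systems
    (P : ℝ → GraphonLQR.L2 →L[ℝ] GraphonLQR.L2)
    (hP : GraphonLQR.IsRiccatiSolution T (GraphonLQR.sysOp α A) (GraphonLQR.sysOp β B) C P₀ P)
    (PN : ℕ → ℝ → GraphonLQR.L2 →L[ℝ] GraphonLQR.L2)
    (hPN : ∀ N, 1 ≤ N → GraphonLQR.IsRiccatiSolution T
      (GraphonLQR.sysOp (αN N) (GraphonLQR.stepKernel (AN N)))
      (GraphonLQR.sysOp (βN N) (GraphonLQR.stepKernel (BN N))) (CN N) (P₀N N) (PN N))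
    -- the initial states
    (x₀N : ℕ → GraphonLQR.L2) (x₀ : GraphonLQR.L2) (hx₀ : Tendsto x₀N atTop (𝓝 x₀))
    -- optimal control and trajectory
    (uOpt xOpt : ℕ → ℝ → GraphonLQR.L2)
    (hOpt : ∀ N, 1 ≤ N → GraphonLQR.IsClosedLoop T
      (GraphonLQR.sysOp (αN N) (GraphonLQR.stepKernel (AN N)))
      (GraphonLQR.sysOp (βN N) (GraphonLQR.stepKernel (BN N)))
      (PN N) (x₀N N) (uOpt N) (xOpt N))
    -- graphon approximate control and trajectory
    (u x : ℕ → ℝ → GraphonLQR.L2)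
    (hApprox : ∀ N, 1 ≤ N → GraphonLQR.IsClosedLoop T
      (GraphonLQR.sysOp (αN N) (GraphonLQR.stepKernel (AN N)))
      (GraphonLQR.sysOp (βN N) (GraphonLQR.stepKernel (BN N)))
      (fun t => GraphonLQR.stepApprox (n * N) (P t)) (x₀N N) (u N) (x N)) :
    (∀ t ∈ Icc 0 T, Tendsto (fun N => ‖xOpt N t - x N t‖) atTop (𝓝 0)) ∧
      Tendsto (fun N => |GraphonLQR.cost T (CN N) (P₀N N) (uOpt N) (xOpt N)
        - GraphonLQR.cost T (CN N) (P₀N N) (u N) (x N)|) atTop (𝓝 0) := by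
  have hT0 : 0 ≤ T := hT.le
  have hge : ∀ᶠ N : ℕ in atTop, 1 ≤ N := eventually_ge_atTop 1
  have hAlim := hA.tendsto_sysOp
  have hBlim := hB.tendsto_sysOp
  have hPd := GraphonLQR.riccati_hasDerivWithinAt hP.continuousOn hP.deriv
  have hPc := GraphonLQR.riccati_continuousOn hP.continuousOn hP.deriv
  have hPNd := fun N hN =>
    GraphonLQR.riccati_hasDerivWithinAt (hPN N hN).continuousOn (hPN N hN).deriv
  have hPNc := fun N hN => GraphonLQR.riccati_continuousOn (hPN N hN).continuousOn (hPN N hN).deriv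
  obtain ⟨m, hm⟩ := isCompact_Icc.exists_bound_of_continuousOn hPc
  obtain ⟨a, ha⟩ := hAlim.norm.bddAbove_range
  obtain ⟨c, hc⟩ := GraphonLQR.exists_norm_le_of_tendsto hCconv
  obtain ⟨p, hp⟩ := GraphonLQR.exists_norm_le_of_tendsto hP₀conv
  have hp0 : 0 ≤ p := (norm_nonneg _).trans (hp 0)
  -- The energy estimate gives a bound independent of `N`; the maximum with `m` lets the same
  -- constant bound the limit solution too.
  have hPNb : ∀ᶠ N in atTop, ∀ t ∈ Icc 0 T,
      ‖PN N t‖ ≤ max m ((p + T * c ^ 2) * Real.exp (T * a) ^ 2) := by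
    filter_upwards [hge] with N hN t ht
    refine le_max_of_le_right
      ((GraphonLQR.riccati_norm_le hT0 (hPN N hN).nonneg (hPNd N hN) t ht).trans ?_)
    have h1 := hp N
    have h2 := hc N
    have h3 : ‖GraphonLQR.sysOp (αN N) (GraphonLQR.stepKernel (AN N))‖ ≤ a := ha ⟨N, rfl⟩
    rw [(hPN N hN).initial]
    gcongr
  have hstrong := GraphonLQR.riccati_tendsto hAlim hBlim
    (GraphonLQR.tendsto_adjoint_apply_of_isSelfAdjoint hCN hC hCconv)
    (hge.mono hPNd) hPd hPNb (fun t ht => le_max_of_le_left (hm t ht))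
    (fun v => by
      rw [hP.initial]
      refine (hP₀conv v).congr' ?_
      filter_upwards [hge] with N hN
      rw [(hPN N hN).initial])
  have hmaps : MapsTo (fun t => T - t) (Icc 0 T) (Icc 0 T) := fun t ht =>
    ⟨by linarith [ht.2], by linarith [ht.1]⟩
  have hPT : ContinuousOn (fun t => P (T - t)) (Icc 0 T) := hPc.comp (by fun_prop) hmaps
  -- The limit trajectory shared by the two feedback laws.
  obtain ⟨y, hy0, hy⟩ := GraphonLQR.exists_linear_ode_solution hT0
    (L := fun t => GraphonLQR.sysOp α A - GraphonLQR.sysOp β B ∘L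
      ((GraphonLQR.sysOp β B)†) ∘L P (T - t))
    (continuousOn_const.sub (continuousOn_const.clm_comp (continuousOn_const.clm_comp hPT))) x₀
  rw [← hy0] at hx₀
  obtain ⟨hx1, hJ1⟩ := GraphonLQR.closedLoop_tendsto hT0 hAlim hBlim hCconv hP₀conv
    (hge.mono hPNc) hPc hPNb hstrong (hge.mono hOpt) hy hx₀
  -- The partitions have `n * N` cells; they become fine because `n` is positive.
  have hnN : Tendsto (fun N : ℕ => n * N) atTop atTop :=
    tendsto_id.const_mul_atTop' (show 0 < n from hn)
  obtain ⟨hx2, hJ2⟩ := GraphonLQR.closedLoop_tendsto hT0 hAlim hBlim hCconv hP₀conv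
    (PN := fun N t => GraphonLQR.stepApprox (n * N) (P t))
    (Eventually.of_forall fun N => GraphonLQR.continuousOn_stepApprox (n * N) hPc) hPc
    (Eventually.of_forall fun N t ht => (GraphonLQR.norm_stepApprox_le (n * N) (P t)).trans (hm t ht))
    (fun t _ v => (GraphonLQR.stepApprox_tendsto (P t) v).comp hnN) (hge.mono hApprox) hy hx₀
  refine ⟨fun t ht => ?_, ?_⟩
  · simpa using ((hx1 t ht).sub (hx2 t ht)).norm
  · simpa using (hJ1.sub hJ2).abs
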